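/- Consider $M$ products; product $i\in[M]=\{1,\dots,M\}$ has unit cost $c_i$ and unit price $p_i$ with $0<c_i<p_i$, mean demand $\mu_i\ge 0$, and profit $\pi_i(q,u)=p_i\min\{q,u\}-c_iq$ when $q$ is ordered and demand is $u$. Let $\alpha\ge 0$, let $\mathcal P_M$ and $\mathcal P$ be the sets of probability distributions on $\mathbb R_+^M$ and $\mathbb R_+$, let $d_{\rm OT}(F,G)$ be the optimal-transport cost (infimum over all couplings of $F$ and $G$) for the cost $\|u-v\|_2^2$, and for $K\in\mathbb R$ let $$\mathcal C=\Big\{G\in\mathcal P_M:\ \mathbb E_G[\tilde v_i]=\mu_i\ \forall i\in[M],\ \ \mathbb E_G\Big[\sum_{i}\tilde v_i^2\Big]\le K\Big\},\qquad d(F,\mathcal C)=\inf_{G\in\mathcal C}d_{\rm OT}(F,G).$$ The set $\mathcal C$ is nonempty if and only if $K\ge\sum_i\mu_i^2$. The multi-product misspecification-averse newsvendor problem is $$\sup_{q\in\mathbb R_+^M}\ \inf_{F\in\mathcal P_M}\Big\{\mathbb E_F\Big[\sum_{i}\pi_i(q_i,\tilde u_i)\Big]+\alpha\, d(F,\mathcal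 C)\Big\}.\tag{P}$$ For $\lambda\ge0$ put $$\Pi^\star_{i,\alpha}(\lambda)=\sup_{q_i\ge0}\ \inf_{F_i\in\mathcal P}\Big\{\mathbb E_{F_i}[\pi_i(q_i,\tilde u_i)]+\inf_{G_i\in\mathcal P,\ \mathbb E_{G_i}[\tilde v_i]=\mu_i}\big\{\lambda\,\mathbb E_{G_i}[\tilde v_i^2]+\alpha\, d_{\rm OT}(F_i,G_i)\big\}\Big\},$$ and call $\lambda^\star\ge 0$ dual optimal for $K$ if it maximizes $\lambda\mapsto-\lambda K+\sum_{i}\Pi^\star_{i,\alpha}(\lambda)$ over $\lambda\ge0$. (a) If $K\ge\sum_i\mu_i^2$, then the optimal value of (P) equals $\sup_{\lambda\ge0}\big\{-\lambda K+\sum_{i}\Pi^\star_{i,\alpha}(\lambda)\big\}$. (b) If $K>\sum_i\mu_i^2$, there is exactly one dual optimal $\lambda^\star$ (so the supremum is a maximum). (c) The dual optimal $\lambda^\star$ is decreasing in $K$ (in the weak sense): if $0\le K_1<K_2$ and $\lambda_1,\lambda_2$ are dual optimal for $K_1,K_2$, then $\lambda_2\le\lambda_1$. (d) Let $\bar\lambda_0=0$,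 $\bar\lambda_i=c_i/(2\mu_i-p_i/\alpha)^+$ for $i\in[M]$ (with $x/0=\infty$ for $x>0$), $\bar\lambda_{M+1}=\infty$, and let the products be numbered so that $\bar\lambda_1\le\dots\le\bar\lambda_M$. For $j\in[M+1]$ and $\lambda\in[0,\infty)$ let $$\Theta_j(\lambda)=\sum_{i=j}^{M}\frac{p_i\mu_i^2(\alpha^2c_i+2\alpha c_i\lambda+p_i\lambda^2)}{(p_i\lambda+\alpha c_i)^2}+\sum_{i=1}^{j-1}\Big(\mu_i^2+\frac{(p_i-c_i)c_i}{4\lambda^2}\Big),\qquad \Theta_j(\infty)=\lim_{\lambda\to\infty}\Theta_j(\lambda)=\sum_{i}\mu_i^2$$ (the quotient $0/0$, which in (i) and (ii) below can arise only for $\alpha=\lambda=0$, is read as $0$). If $K>\sum_i\mu_i^2$, then $i^\star=\min\{j\in[M+1]:\Theta_j(\bar\lambda_j)<K\}$ exists, and the dual optimal $\lambda^\star$ is as follows. (i) If $\Theta_{i^\star}(\bar\lambda_{i^\star-1})\le K$, then $\lambda^\star=\bar\lambda_{i^\star-1}$. (ii) If $\Theta_{i^\star}(\bar\lambda_{i^\star-1})>K$,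 then $\lambda^\star$ is the unique $\lambda\in(\bar\lambda_{i^\star-1},\bar\lambda_{i^\star})$ with $\Theta_{i^\star}(\lambda)=K$. -/

import Mathlib

open MeasureTheory
open scoped ENNReal NNReal

noncomputable section

/-- Profit of one product with unit price `p`, unit cost `c`, order quantity `q`, demand `u`. -/
def profit (p c q u : ℝ) : ℝ := p * min q u - c * q

/-- Optimal-transport cost between the probability distributions `F` and `G`
for the cost function `cost`: infimum over all couplings. -/
def otCost {X : Type*} [MeasurableSpace X] (cost : X → X → ℝ≥0∞)
    (F G : ProbabilityMeasure X) : ℝ≥0∞ :=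
  ⨅ (Γ : Measure (X × X))
    (_ : Γ.map Prod.fst = (F : Measure X) ∧ Γ.map Prod.snd = (G : Measure X)),
    ∫⁻ z, cost z.1 z.2 ∂Γ

/-- The cost `|u - v|²` on the half-line. -/
def sqCost (u v : ℝ≥0) : ℝ≥0∞ := ENNReal.ofReal (((u : ℝ) - (v : ℝ)) ^ 2)

/-- The cost `‖u - v‖₂²` on the nonnegative orthant. -/
def sqCostMulti {M : ℕ} (u v : Fin M → ℝ≥0) : ℝ≥0∞ :=
  ENNReal.ofReal (∑ i, ((u i : ℝ) - (v i : ℝ)) ^ 2)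

/-- Distributions on the nonnegative orthant with means `μ i` and with
expected sum of squares at most `K`. -/
def ambiguitySet {M : ℕ} (μ : Fin M → ℝ) (K : ℝ) :
    Set (ProbabilityMeasure (Fin M → ℝ≥0)) :=
  {G | (∀ i, ∫⁻ v, (v i : ℝ≥0∞) ∂(G : Measure (Fin M → ℝ≥0)) = ENNReal.ofReal (μ i)) ∧
    ∫⁻ v, ∑ i, (v i : ℝ≥0∞) ^ 2 ∂(G : Measure (Fin M → ℝ≥0)) ≤ ENNReal.ofReal K}

/-- Distributions on the half-line with mean `μ`. -/
def meanSet (μ : ℝ) : Set (ProbabilityMeasure ℝ≥0) :=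
  {G | ∫⁻ v, (v : ℝ≥0∞) ∂(G : Measure ℝ≥0) = ENNReal.ofReal μ}

/-- Optimal-transport distance from `F` to the set `C` of distributions. -/
def distToSet {M : ℕ} (F : ProbabilityMeasure (Fin M → ℝ≥0))
    (C : Set (ProbabilityMeasure (Fin M → ℝ≥0))) : ℝ≥0∞ :=
  ⨅ G ∈ C, otCost sqCostMulti F G

/-- Optimal value of the multi-product misspecification-averse newsvendor problem
`max_{q ≥ 0} min_F { E_F[∑ π_i(q_i, u_i)] + α d(F, C) }`. -/
def multiValue {M : ℕ} (p c μ : Fin M → ℝ) (α K : ℝ) : EReal :=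
  ⨆ q : Fin M → ℝ≥0, ⨅ F : ProbabilityMeasure (Fin M → ℝ≥0),
    ((∫ u, ∑ i, profit (p i) (c i) (q i) (u i) ∂(F : Measure (Fin M → ℝ≥0)) : ℝ) : EReal) +
      ((ENNReal.ofReal α * distToSet F (ambiguitySet μ K) : ℝ≥0∞) : EReal)

/-- Optimal value of the single-product problem
`max_{q ≥ 0} min_F { E_F[π(q, u)] + min_{G : E_G[v] = μ} { lam E_G[v²] + α d_OT(F, G) } }`. -/
def singleValue (p c μ α lam : ℝ) : EReal :=
  ⨆ q : ℝ≥0, ⨅ F : ProbabilityMeasure ℝ≥0,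
    ((∫ u, profit p c q u ∂(F : Measure ℝ≥0) : ℝ) : EReal) +
      ((⨅ G ∈ meanSet μ,
        (ENNReal.ofReal lam * ∫⁻ v, (v : ℝ≥0∞) ^ 2 ∂(G : Measure ℝ≥0) +
          ENNReal.ofReal α * otCost sqCost F G) : ℝ≥0∞) : EReal)

/-- The dual objective `-lam K + ∑ i, Π_{i,α}(lam)`. -/
def dualObjective {M : ℕ} (p c μ : Fin M → ℝ) (α K lam : ℝ) : EReal :=
  ((-(lam * K) : ℝ) : EReal) + ∑ i, singleValue (p i) (c i) (μ i) α lam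

/-- `lam` is an optimal solution of the dual problem `max_{lam ≥ 0} dualObjective lam`. -/
def IsDualOptimal {M : ℕ} (p c μ : Fin M → ℝ) (α K lam : ℝ) : Prop :=
  0 ≤ lam ∧ IsMaxOn (dualObjective p c μ α K) (Set.Ici 0) lam

/-- The breakpoint `c / (2 μ - p / α)⁺` of a product, with `x / 0 = ∞` for `x > 0`
(the subtraction of extended nonnegative reals is the positive part of the difference). -/
def breakpoint (p c μ α : ℝ) : ℝ≥0∞ :=
  ENNReal.ofReal c / (2 * ENNReal.ofReal μ - ENNReal.ofReal p / ENNReal.ofReal α)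

/-- The breakpoints indexed by `0, 1, …, M + 1`: the first is `0`, the last is `∞`,
and the one with index `i + 1` belongs to the product `i : Fin M` (products count from zero). -/
def lamBar {M : ℕ} (p c μ : Fin M → ℝ) (α : ℝ) : ℕ → ℝ≥0∞
  | 0 => 0
  | j + 1 => if h : j < M then breakpoint (p ⟨j, h⟩) (c ⟨j, h⟩) (μ ⟨j, h⟩) α else ⊤

/-- The function `Θ_j` at a finite `lam`: products with one-based index at least `j` contribute
to the first sum, the others to the second one. -/
def thetaFin {M : ℕ} (p c μ : Fin M → ℝ) (α : ℝ) (j : ℕ) (lam : ℝ) : ℝ :=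
  (∑ i : Fin M with j ≤ i.val + 1,
    p i * μ i ^ 2 * (α ^ 2 * c i + 2 * α * c i * lam + p i * lam ^ 2) /
      (p i * lam + α * c i) ^ 2) +
  ∑ i : Fin M with i.val + 1 < j, (μ i ^ 2 + (p i - c i) * c i / (4 * lam ^ 2))

/-- The function `Θ_j` on `[0, ∞]`; its value at `∞` is the limit, `∑ i, μ i ^ 2`
(see `tendsto_thetaFin`). -/
def theta {M : ℕ} (p c μ : Fin M → ℝ) (α : ℝ) (j : ℕ) (lam : ℝ≥0∞) : ℝ :=
  if lam = ⊤ then ∑ i, μ i ^ 2 else thetaFin p c μ α j lam.toReal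

/-- The indices `j ∈ {1, …, M + 1}` with `Θ_j` less than `K` at the breakpoint of index `j`. -/
def indexSet {M : ℕ} (p c μ : Fin M → ℝ) (α K : ℝ) : Set ℕ :=
  {j | 1 ≤ j ∧ j ≤ M + 1 ∧ theta p c μ α j (lamBar p c μ α j) < K}

theorem tendsto_thetaFin {M : ℕ} (p c μ : Fin M → ℝ) (α : ℝ) (j : ℕ) (hp : ∀ i, 0 < p i) :
    Filter.Tendsto (thetaFin p c μ α j) Filter.atTop (nhds (∑ i, μ i ^ 2)) := by
  have hinv : Filter.Tendsto (fun x : ℝ => x⁻¹) Filter.atTop (nhds 0) := tendsto_inv_atTop_zero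
  have key : (∑ i, μ i ^ 2) = (∑ i : Fin M with j ≤ i.val + 1, μ i ^ 2) +
      ∑ i : Fin M with i.val + 1 < j, μ i ^ 2 := by
    rw [← Finset.sum_filter_add_sum_filter_not Finset.univ (fun i : Fin M => j ≤ i.val + 1)]
    simp only [not_le]
  rw [key]
  refine Filter.Tendsto.add (tendsto_finsetSum _ fun i _ => ?_)
    (tendsto_finsetSum _ fun i _ => ?_)
  · have hpi := hp i
    have h1 : Filter.Tendsto (fun x : ℝ => p i * μ i ^ 2 *
        (α ^ 2 * c i * (x⁻¹ * x⁻¹) + 2 * α * c i * x⁻¹ + p i) / (p i + α * c i * x⁻¹) ^ 2)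
        Filter.atTop (nhds (p i * μ i ^ 2 *
        (α ^ 2 * c i * (0 * 0) + 2 * α * c i * 0 + p i) / (p i + α * c i * 0) ^ 2)) := by
      refine Filter.Tendsto.div ?_ ?_ (by simp [hpi.ne'])
      · exact ((((hinv.mul hinv).const_mul _).add (hinv.const_mul _)).add_const _).const_mul _
      · exact ((hinv.const_mul _).const_add _).pow 2
    have h2 : p i * μ i ^ 2 * (α ^ 2 * c i * (0 * 0) + 2 * α * c i * 0 + p i) /
        (p i + α * c i * 0) ^ 2 = μ i ^ 2 := by
      have := hpi.ne'
      simp only [mul_zero, add_zero, zero_add]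
      field_simp
    rw [h2] at h1
    refine h1.congr' ?_
    filter_upwards [Filter.eventually_gt_atTop 0] with x hx
    have e1 : α ^ 2 * c i + 2 * α * c i * x + p i * x ^ 2 =
        (α ^ 2 * c i * (x⁻¹ * x⁻¹) + 2 * α * c i * x⁻¹ + p i) * x ^ 2 := by
      field_simp
    have e2 : (p i * x + α * c i) ^ 2 = (p i + α * c i * x⁻¹) ^ 2 * x ^ 2 := by
      field_simp
    have hx2 : x ^ 2 ≠ 0 := by positivity
    rw [e1, e2, ← mul_assoc (p i * μ i ^ 2), mul_div_mul_right _ _ hx2]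
  · have h1 : Filter.Tendsto (fun x : ℝ => μ i ^ 2 + (p i - c i) * c i / 4 * (x⁻¹ * x⁻¹))
        Filter.atTop (nhds (μ i ^ 2 + (p i - c i) * c i / 4 * (0 * 0))) :=
      ((hinv.mul hinv).const_mul _).const_add _
    simp only [mul_zero, add_zero] at h1
    refine h1.congr' ?_
    filter_upwards [Filter.eventually_gt_atTop 0] with x hx
    field_simp

end

/-! Everything follows from solving the one-product problem in closed form for a fixed multiplier
`lam`. Nature uses a two-point reference law with mean `μ`, at `μ - c * r` with weight `1 - c / p`
and at `μ + (p - c) * r` with weight `c / p`, and transports only its low point. The weight `c / p`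
is the newsvendor's critical ratio: the resulting bound on the expected profit no longer depends on
`q`, and nature is left with minimizing `lam * (μ ^ 2 + c * (p - c) * r ^ 2) + (1 - c / p) * huber p
α (μ - c * r)`. The slope of `huber` at `v` is `min (2 * α * v) p`, so stationarity gives `r =
spread`; the two arguments of its `max` correspond to the two regimes of `huber`.

Optimality is proved by weak duality: `exists_certificate` gives an order quantity and a slope for
which a pointwise inequality in `(u, v)` holds, and integrating it over any coupling bounds the
value from below. Since `lam` enters linearly, the same two-point law tested at another multiplier
shows that `secondMoment` is a supergradient of the value (`singleValue_le_supergradient`).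

Hence the dual objective is concave with supergradient `totalMoment - K`, and `totalMoment` is
continuous, decreasing, and tends to `∑ i, μ i ^ 2`. Dual optimality becomes `totalMoment ≤ K` with
complementary slackness (`isDualOptimal_iff`), which yields existence and uniqueness. At the dual
optimum the two-point laws of all products together satisfy the constraints of the ambiguity set,
and this closes the duality gap. Finally, a breakpoint is where the `max` in `spread` switches, so
`theta` coincides with `totalMoment` between consecutive breakpoints. -/

/-- The gap between the two demand levels of the worst-case distribution, divided by the price. -/
noncomputable def spread (p c μ α lam : ℝ) : ℝ :=
  α * μ / max (p * lam + α * c) (2 * α * μ * lam)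

/-- The low demand level of the worst-case reference distribution. -/
noncomputable def lowPoint (p c μ α lam : ℝ) : ℝ := μ - c * spread p c μ α lam

/-- The high demand level of the worst-case reference distribution. -/
noncomputable def highPoint (p c μ α lam : ℝ) : ℝ := μ + (p - c) * spread p c μ α lam

/-- The second moment of the worst-case reference distribution. -/
noncomputable def secondMoment (p c μ α lam : ℝ) : ℝ :=
  μ ^ 2 + c * (p - c) * spread p c μ α lam ^ 2

/-- The minimum over `u ≥ 0` of `p * u + α * (u - v) ^ 2`. -/
noncomputable def huber (p α v : ℝ) : ℝ :=
  if 2 * α * v ≤ p then α * v ^ 2 else p * v - p ^ 2 / (4 * α)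

/-- The minimizer over `u ≥ 0` of `p * u + α * (u - v) ^ 2`. -/
noncomputable def transported (p α v : ℝ) : ℝ :=
  if 2 * α * v ≤ p then 0 else v - p / (2 * α)

/-- The optimal value of the single-product problem. -/
noncomputable def productValue (p c μ α lam : ℝ) : ℝ :=
  lam * secondMoment p c μ α lam + (1 - c / p) * huber p α (lowPoint p c μ α lam)

/-! ### Algebra of one product: two-point laws, dual certificates, second moments, breakpoints. -/

section Product

variable {p c μ α lam : ℝ}

theorem spread_denom_pos (hc : 0 < c) (hcp : c < p) (hα : 0 < α) (hl : 0 ≤ lam) :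
    0 < max (p * lam + α * c) (2 * α * μ * lam) :=
  lt_max_of_lt_left (by have := hc.trans hcp; positivity)

theorem spread_nonneg (hc : 0 < c) (hcp : c < p) (hμ : 0 ≤ μ) (hα : 0 ≤ α) (hl : 0 ≤ lam) :
    0 ≤ spread p c μ α lam := by
  have := hc.trans hcp
  exact div_nonneg (by positivity) (le_max_of_le_left (by positivity))

/-- Covers `lam = 0` as well, where the quotient is `0 / 0`. Zero is the wanted value: transport is
free for `α = 0`, so spreading the reference law brings nature nothing. -/
theorem spread_of_zero : spread p c μ 0 lam = 0 := by simp [spread]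

theorem spread_of_le (h : 2 * α * μ * lam ≤ p * lam + α * c) :
    spread p c μ α lam = α * μ / (p * lam + α * c) := by rw [spread, max_eq_left h]

theorem spread_of_ge (h : p * lam + α * c ≤ 2 * α * μ * lam) :
    spread p c μ α lam = α * μ / (2 * α * μ * lam) := by rw [spread, max_eq_right h]

theorem lowPoint_nonneg (hc : 0 < c) (hcp : c < p) (hμ : 0 ≤ μ) (hα : 0 ≤ α) (hl : 0 ≤ lam) :
    0 ≤ lowPoint p c μ α lam := by
  have hp := hc.trans hcp
  rcases hα.eq_or_lt with rfl | hα
  · simpa [lowPoint, spread_of_zero] using hμ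
  have hD := spread_denom_pos (μ := μ) hc hcp hα hl
  rw [lowPoint, spread, sub_nonneg, mul_div_assoc', div_le_iff₀ hD]
  have : α * c ≤ max (p * lam + α * c) (2 * α * μ * lam) :=
    le_max_of_le_left (by nlinarith [mul_nonneg hp.le hl])
  nlinarith

theorem highPoint_nonneg (hc : 0 < c) (hcp : c < p) (hμ : 0 ≤ μ) (hα : 0 ≤ α) (hl : 0 ≤ lam) :
    0 ≤ highPoint p c μ α lam :=
  add_nonneg hμ (mul_nonneg (sub_nonneg.2 hcp.le) (spread_nonneg hc hcp hμ hα hl))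

theorem transported_nonneg {v : ℝ} (hp : 0 < p) (hα : 0 ≤ α) : 0 ≤ transported p α v := by
  rw [transported]
  split_ifs with h
  · exact le_rfl
  · rcases hα.eq_or_lt with rfl | hα
    · simp only [mul_zero, zero_mul, not_le] at h
      exact absurd h hp.not_gt
    · rw [sub_nonneg, div_le_iff₀ (by positivity)]
      linarith

theorem mean_twoPoint (hp : p ≠ 0) (r : ℝ) :
    (1 - c / p) * (μ - c * r) + c / p * (μ + (p - c) * r) = μ := by
  field_simp
  ring

theorem secondMoment_twoPoint (hp : p ≠ 0) (r : ℝ) :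
    (1 - c / p) * (μ - c * r) ^ 2 + c / p * (μ + (p - c) * r) ^ 2 =
      μ ^ 2 + c * (p - c) * r ^ 2 := by
  field_simp
  ring

/-- Replacing `min q u` by `u` leaves exactly the minimization that defines `huber`. -/
theorem profit_add_transported (hp : 0 < p) (q v : ℝ) (hα : 0 ≤ α) :
    profit p c q (transported p α v) + α * (transported p α v - v) ^ 2 ≤
      huber p α v - c * q := by
  have hmin := mul_le_mul_of_nonneg_left (min_le_right q (transported p α v)) hp.le
  rw [profit]
  suffices p * transported p α v + α * (transported p α v - v) ^ 2 ≤ huber p α v by linarith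
  rw [transported, huber]
  split_ifs with h
  · simp
  · rcases hα.eq_or_lt with rfl | hα
    · simp
    · apply le_of_eq
      field_simp
      ring

/-- Against the two-point distribution with low level `v` and high level `v'` no order quantity
earns more than the share `1 - c / p` of the Huber function at `v`. -/
theorem twoPoint_le (hc : 0 < c) (hcp : c < p) (hα : 0 ≤ α) (q v v' : ℝ) :
    (1 - c / p) * (profit p c q (transported p α v) + α * (transported p α v - v) ^ 2) +
      c / p * (profit p c q v' + α * (v' - v') ^ 2) ≤ (1 - c / p) * huber p α v := by
  have hp := hc.trans hcp
  have h1 : 0 ≤ 1 - c / p := by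
    rw [sub_nonneg, div_le_one hp]
    exact hcp.le
  have h2 := mul_le_mul_of_nonneg_left (profit_add_transported (c := c) hp q v hα) h1
  have h3 : profit p c q v' + α * (v' - v') ^ 2 ≤ (p - c) * q := by
    have := mul_le_mul_of_nonneg_left (min_le_left q v') hp.le
    simp only [profit, sub_self]
    linarith
  have h4 := mul_le_mul_of_nonneg_left h3 (div_nonneg hc.le hp.le)
  -- The critical ratio makes `q` cancel.
  have h5 : (1 - c / p) * (huber p α v - c * q) + c / p * ((p - c) * q) =
      (1 - c / p) * huber p α v := by
    field_simp
    ring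
  linarith

/-- The optimal order quantity of a product and the multiplier of its mean constraint. -/
theorem exists_certificate (hc : 0 < c) (hcp : c < p) (hμ : 0 ≤ μ) (hα : 0 ≤ α) (hl : 0 ≤ lam) :
    ∃ q s : ℝ, 0 ≤ q ∧ ∀ u v : ℝ, 0 ≤ u → 0 ≤ v →
      productValue p c μ α lam + s * (v - μ) ≤
        profit p c q u + (lam * v ^ 2 + α * (u - v) ^ 2) := by
  have hp := hc.trans hcp
  rcases hα.eq_or_lt with rfl | hα
  -- For `α = 0` the certificate is the tangent of `lam * v ^ 2` at `μ`.
  · refine ⟨0, 2 * lam * μ, le_rfl, fun u v hu hv => ?_⟩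
    simp only [productValue, secondMoment, spread_of_zero, huber, profit, min_eq_left hu]
    simp only [mul_zero, zero_mul, hp.le, if_true]
    nlinarith [mul_nonneg hl (sq_nonneg (v - μ))]
  have hD : 0 < p * lam + α * c := by positivity
  have hla : 0 < lam + α := by positivity
  rcases le_total (2 * α * μ * lam) (p * lam + α * c) with h | h
  -- Here the low level `W` is transported all the way to `0`; `V` is the high level.
  · set V := μ * p * (lam + α) / (p * lam + α * c) with hV
    set W := μ * p * lam / (p * lam + α * c) with hW
    have hWV : (lam + α) * W = lam * V := by
      rw [hV, hW]
      field_simp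
    have hlow : lowPoint p c μ α lam = W := by
      rw [lowPoint, spread_of_le h, hW]
      field_simp
      ring
    have hW2 : 2 * α * W ≤ p := by
      rw [hW, mul_div_assoc', div_le_iff₀ hD]
      nlinarith
    have hW0 : 0 ≤ W := by positivity
    have hV0 : 0 ≤ V := by positivity
    -- The slope `2 * lam * V = 2 * (lam + α) * W` gives tangency at both support points `(0, W)`
    -- and `(V, V)` of the coupling, and this `q` makes the inequality tight at both.
    set q := lam * α * V ^ 2 / (p * (lam + α)) with hq
    have hpq : p * q = lam * V ^ 2 - (lam + α) * W ^ 2 := by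
      rw [hq, hV, hW]
      field_simp
      ring
    have hval : productValue p c μ α lam = (p - c) * q - lam * V ^ 2 + 2 * lam * V * μ := by
      rw [productValue, hlow, huber, if_pos hW2, secondMoment, spread_of_le h, hq, hV, hW]
      field_simp
      ring
    refine ⟨q, 2 * lam * V, by positivity, fun u v hu hv => ?_⟩
    clear_value q V W
    rw [hval, profit]
    rcases le_total q u with hqu | hqu
    · rw [min_eq_left hqu]
      nlinarith [mul_nonneg hl (sq_nonneg (v - V)), mul_nonneg hα.le (sq_nonneg (u - v))]
    · rw [min_eq_right hqu]
      have key : 0 ≤ p * u + α * u ^ 2 - 2 * α * u * v + (lam + α) * (v - W) ^ 2 := by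
        have e : (lam + α) * (p * u + α * u ^ 2 - 2 * α * u * v + (lam + α) * (v - W) ^ 2) =
            (lam + α) * (u * (p - 2 * α * W)) + α * lam * u ^ 2 +
              ((lam + α) * (v - W) - α * u) ^ 2 := by ring
        refine (mul_nonneg_iff_of_pos_left hla).1 ?_
        rw [e]
        have := mul_nonneg hu (sub_nonneg.2 hW2)
        positivity
      have e2 : 2 * lam * V * v = 2 * ((lam + α) * W) * v := by rw [hWV]; ring
      linear_combination key + e2 + hpq
  · have hl0 : 0 < lam := hl.lt_of_ne fun h0 => by
      rw [← h0] at h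
      nlinarith [mul_pos hα hc]
    have hμ0 : 0 < μ := hμ.lt_of_ne fun h0 => by
      rw [← h0] at h
      nlinarith [mul_pos hα hc, mul_pos hp hl0]
    have hr : spread p c μ α lam = 1 / (2 * lam) := by
      rw [spread_of_ge h]
      field_simp
    set W := μ - c / (2 * lam) with hW
    have hlow : lowPoint p c μ α lam = W := by
      rw [lowPoint, hr, hW]
      ring
    have hW2 : p / (2 * α) ≤ W := by
      rw [hW, le_sub_iff_add_le, div_add_div _ _ (by positivity) (by positivity),
        div_le_iff₀ (by positivity)]
      nlinarith
    -- The midpoint of the transported low level `W - p / (2 * α)` and the high level `W + p / (2 *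
    -- lam)`; again the inequality is tight at both support points.
    set q := W + p / (4 * lam) - p / (4 * α) with hq
    have hq0 : 0 ≤ q := by
      have : p / (2 * α) - p / (4 * α) = p / (4 * α) := by field_simp; ring
      have h1 : 0 ≤ p / (4 * lam) := by positivity
      have h2 : 0 ≤ p / (4 * α) := by positivity
      linarith
    have hhub : huber p α W = p * W - p ^ 2 / (4 * α) := by
      rw [huber]
      split_ifs with h'
      · have : p / (2 * α) = W := by
          refine le_antisymm hW2 ?_
          rw [le_div_iff₀ (by positivity)]
          linarith
        rw [← this]
        field_simp
        ring
      · rfl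
    have hval : productValue p c μ α lam =
        p * q - c * q - lam * (W + p / (2 * lam)) ^ 2 + (2 * lam * W + p) * μ := by
      rw [productValue, hlow, hhub, secondMoment, hr, hq, hW]
      field_simp
      ring
    refine ⟨q, 2 * lam * W + p, hq0, fun u v hu hv => ?_⟩
    rw [hval, profit]
    rcases le_total q u with hqu | hqu
    · rw [min_eq_left hqu]
      have e : lam * v ^ 2 - (2 * lam * W + p) * v + lam * (W + p / (2 * lam)) ^ 2 =
          lam * (v - (W + p / (2 * lam))) ^ 2 := by
        field_simp
        ring
      nlinarith [mul_nonneg hl (sq_nonneg (v - (W + p / (2 * lam)))),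
        mul_nonneg hα.le (sq_nonneg (u - v))]
    · rw [min_eq_right hqu]
      have e : p * u + lam * v ^ 2 + α * (u - v) ^ 2 - (2 * lam * W + p) * v - p * q +
          lam * (W + p / (2 * lam)) ^ 2 =
          α * (u - v + p / (2 * α)) ^ 2 + lam * (v - W) ^ 2 := by
        rw [hq]
        field_simp
        ring
      have : 0 ≤ α * (u - v + p / (2 * α)) ^ 2 + lam * (v - W) ^ 2 := by positivity
      linarith

theorem sq_le_secondMoment (hc : 0 < c) (hcp : c < p) : μ ^ 2 ≤ secondMoment p c μ α lam :=
  le_add_of_nonneg_right (mul_nonneg (mul_nonneg hc.le (sub_nonneg.2 hcp.le)) (sq_nonneg _))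

theorem secondMoment_eq_of_mul_eq_zero (h : α * μ = 0) : secondMoment p c μ α lam = μ ^ 2 := by
  simp [secondMoment, spread, h]

theorem continuousOn_spread (hc : 0 < c) (hcp : c < p) (hα : 0 < α) :
    ContinuousOn (spread p c μ α) (Set.Ici 0) := by
  unfold spread
  refine ContinuousOn.div (by fun_prop) (by fun_prop) fun x hx => ?_
  exact (spread_denom_pos hc hcp hα hx).ne'

theorem continuousOn_secondMoment (hc : 0 < c) (hcp : c < p) (hα : 0 ≤ α) :
    ContinuousOn (secondMoment p c μ α) (Set.Ici 0) := by
  rcases hα.eq_or_lt with rfl | hα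
  · exact (continuousOn_const (c := μ ^ 2)).congr fun x _ =>
      secondMoment_eq_of_mul_eq_zero (by simp)
  · exact (((continuousOn_spread hc hcp hα).pow 2).const_smul (c * (p - c))).const_add (μ ^ 2)

theorem tendsto_spread (hp : 0 < p) :
    Filter.Tendsto (spread p c μ α) Filter.atTop (nhds 0) := by
  unfold spread
  refine Filter.Tendsto.div_atTop tendsto_const_nhds ?_
  refine Filter.tendsto_atTop_mono (fun x => le_max_left _ _) ?_
  exact Filter.tendsto_atTop_add_const_right _ _ (Filter.tendsto_id.const_mul_atTop hp)

theorem tendsto_secondMoment (hp : 0 < p) :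
    Filter.Tendsto (secondMoment p c μ α) Filter.atTop (nhds (μ ^ 2)) := by
  have := (((tendsto_spread (c := c) (μ := μ) (α := α) hp).pow 2).const_mul
    (c * (p - c))).const_add (μ ^ 2)
  simpa [funext fun x => secondMoment.eq_1 p c μ α x] using this

/-- Both arguments of the `max` in `spread` increase strictly with `lam`, because `α * μ > 0`. -/
theorem secondMoment_strictAntiOn (hc : 0 < c) (hcp : c < p) (hμ : 0 < μ) (hα : 0 < α) :
    StrictAntiOn (secondMoment p c μ α) (Set.Ici 0) := by
  intro x hx y hy hxy
  have hp := hc.trans hcp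
  have hD := spread_denom_pos (μ := μ) hc hcp hα hx
  have hs : spread p c μ α y < spread p c μ α x := by
    refine div_lt_div_of_pos_left (by positivity) hD ?_
    refine max_lt_max (by nlinarith) ?_
    exact mul_lt_mul_of_pos_left hxy (by positivity)
  have hs0 := spread_nonneg hc hcp hμ.le hα.le hy
  have h2 : spread p c μ α y ^ 2 < spread p c μ α x ^ 2 := by gcongr
  have h3 : 0 < c * (p - c) := mul_pos hc (sub_pos.2 hcp)
  simp only [secondMoment]
  nlinarith

theorem secondMoment_antitoneOn (hc : 0 < c) (hcp : c < p) (hμ : 0 ≤ μ) (hα : 0 ≤ α) :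
    AntitoneOn (secondMoment p c μ α) (Set.Ici 0) := by
  by_cases h : α * μ = 0
  · intro x _ y _ _
    simp [secondMoment_eq_of_mul_eq_zero h]
  · obtain ⟨h1, h2⟩ := mul_ne_zero_iff.1 h
    exact (secondMoment_strictAntiOn hc hcp (hμ.lt_of_ne' h2) (hα.lt_of_ne' h1)).antitoneOn

theorem continuous_huber (hα : 0 ≤ α) (hp : 0 < p) : Continuous (huber p α) := by
  unfold huber
  refine Continuous.if_le (by fun_prop) (by fun_prop) (by fun_prop) (by fun_prop) fun v hv => ?_
  have hα0 : α ≠ 0 := by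
    rintro rfl
    simp at hv
    exact hp.ne hv
  rw [← hv]
  field_simp
  ring

theorem secondMoment_of_le (hc : 0 < c) (hcp : c < p) (hα : 0 < α) (hl : 0 ≤ lam)
    (h : 2 * α * μ * lam ≤ p * lam + α * c) :
    secondMoment p c μ α lam = p * μ ^ 2 * (α ^ 2 * c + 2 * α * c * lam + p * lam ^ 2) /
      (p * lam + α * c) ^ 2 := by
  have hp := hc.trans hcp
  have hD : 0 < p * lam + α * c := by positivity
  rw [secondMoment, spread_of_le h]
  field_simp
  ring

theorem secondMoment_of_ge (hc : 0 < c) (hcp : c < p) (hα : 0 < α) (hl : 0 ≤ lam)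
    (h : p * lam + α * c ≤ 2 * α * μ * lam) :
    secondMoment p c μ α lam = μ ^ 2 + (p - c) * c / (4 * lam ^ 2) := by
  have hp := hc.trans hcp
  have h0 : 0 < 2 * α * μ * lam := lt_of_lt_of_le (by positivity) h
  have hμ0 : μ ≠ 0 := by rintro rfl; simp at h0
  have hl0 : lam ≠ 0 := by rintro rfl; simp at h0
  rw [secondMoment, spread_of_ge h]
  field_simp
  ring

/-- The breakpoint is where the two arguments of the `max` in `spread` cross. If `2 * μ - p / α ≤ 0`
they never do, matching the value `⊤` of the quotient. -/
theorem ofReal_le_breakpoint_iff (hc : 0 < c) (hcp : c < p) (hα : 0 < α)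
    (hl : 0 ≤ lam) :
    ENNReal.ofReal lam ≤ breakpoint p c μ α ↔ 2 * α * μ * lam ≤ p * lam + α * c := by
  have hp := hc.trans hcp
  have hX : 2 * ENNReal.ofReal μ - ENNReal.ofReal p / ENNReal.ofReal α =
      ENNReal.ofReal (2 * μ - p / α) := by
    rw [ENNReal.ofReal_sub _ (by positivity), ENNReal.ofReal_mul zero_le_two,
      ENNReal.ofReal_div_of_pos hα, ENNReal.ofReal_ofNat]
  rw [breakpoint, hX, ENNReal.le_div_iff_mul_le (.inr (by simpa using hc)) (.inr (by simp)),
    ← ENNReal.ofReal_mul hl, ENNReal.ofReal_le_ofReal_iff hc.le]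
  have e : lam * (2 * μ - p / α) = (2 * α * μ * lam - p * lam) / α := by field_simp
  rw [e, div_le_iff₀ hα]
  constructor <;> intro h <;> linarith

/-- If the inequality failed at `lam`, by continuity it would fail at some `y > lam`, which then
lies below the breakpoint although `lam` lies above it. -/
theorem le_of_breakpoint_le_ofReal (hc : 0 < c) (hcp : c < p) (hα : 0 < α)
    (hl : 0 ≤ lam) (h : breakpoint p c μ α ≤ ENNReal.ofReal lam) :
    p * lam + α * c ≤ 2 * α * μ * lam := by
  have hp := hc.trans hcp
  obtain ⟨x, hx0, hx⟩ : ∃ x : ℝ, 0 ≤ x ∧ breakpoint p c μ α = ENNReal.ofReal x :=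
    ⟨_, ENNReal.toReal_nonneg,
      (ENNReal.ofReal_toReal (ne_top_of_le_ne_top ENNReal.ofReal_ne_top h)).symm⟩
  by_contra! hlt
  have hcont : ∀ᶠ y in nhdsWithin lam (Set.Ioi lam),
      2 * α * μ * y < p * y + α * c :=
    nhdsWithin_le_nhds (ContinuousAt.eventually_lt (by fun_prop) (by fun_prop) hlt)
  obtain ⟨y, hy, hly⟩ := (hcont.and self_mem_nhdsWithin).exists
  have hly : lam < y := hly
  have := ((ofReal_le_breakpoint_iff hc hcp hα (hl.trans hly.le)).2 hy.le).trans h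
  rw [ENNReal.ofReal_le_ofReal_iff hl] at this
  linarith

end Product

/-! ### Extended-real bookkeeping and integrals of two-valued functions. -/

theorem EReal.coe_finset_sum' {ι : Type*} (s : Finset ι) (f : ι → ℝ) :
    ((∑ i ∈ s, f i : ℝ) : EReal) = ∑ i ∈ s, (f i : EReal) := by
  classical
  induction s using Finset.induction_on with
  | empty => simp
  | insert a s ha ih => rw [Finset.sum_insert ha, Finset.sum_insert ha, EReal.coe_add, ih]

theorem EReal.coe_le_coe_add_ennreal {x a : ℝ} {X : ℝ≥0∞} (h : ENNReal.ofReal (x - a) ≤ X) :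
    (x : EReal) ≤ (a : EReal) + (X : EReal) := by
  induction X with
  | top => simp
  | coe r =>
    have h1 : x - a ≤ r := (ENNReal.ofReal_le_iff_le_toReal ENNReal.coe_ne_top).1 h
    rw [show ((r : ℝ≥0∞) : EReal) = ((r : ℝ) : EReal) from rfl, ← EReal.coe_add,
      EReal.coe_le_coe_iff]
    linarith

theorem EReal.coe_add_ennreal_le {a y z : ℝ} {X : ℝ≥0∞} (hy : 0 ≤ y)
    (hX : X ≤ ENNReal.ofReal y) (h : a + y ≤ z) : (a : EReal) + (X : EReal) ≤ (z : EReal) := by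
  calc (a : EReal) + (X : EReal) ≤ a + ((ENNReal.ofReal y : ℝ≥0∞) : EReal) := by
        gcongr
        exact_mod_cast hX
    _ = ((a + y : ℝ) : EReal) := by
        rw [EReal.coe_ennreal_ofReal, max_eq_left hy, EReal.coe_add]
    _ ≤ z := by exact_mod_cast h

open Classical in
/-- The function equal to `a` on `A` and to `b` elsewhere. -/
noncomputable def twoPoint {Ω X : Type*} (A : Set Ω) (a b : X) (ω : Ω) : X := if ω ∈ A then a else b

theorem comp_twoPoint {Ω X Y : Type*} (g : X → Y) (A : Set Ω) (a b : X) (ω : Ω) :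
    g (twoPoint A a b ω) = twoPoint A (g a) (g b) ω := by
  unfold twoPoint
  split_ifs <;> rfl

theorem comp_twoPoint₂ {Ω X X' Y : Type*} (g : X → X' → Y) (A : Set Ω) (a b : X) (a' b' : X')
    (ω : Ω) : g (twoPoint A a b ω) (twoPoint A a' b' ω) = twoPoint A (g a a') (g b b') ω := by
  unfold twoPoint
  split_ifs <;> rfl

section Integrals

variable {Ω : Type*} [MeasurableSpace Ω] {ν : Measure Ω}

/-- No integrability is needed: the integral of a non-integrable function is `0`. -/
theorem ofReal_integral_le_lintegral (ν : Measure Ω) (f : Ω → ℝ) :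
    ENNReal.ofReal (∫ x, f x ∂ν) ≤ ∫⁻ x, ENNReal.ofReal (f x) ∂ν := by
  by_cases hf : Integrable f ν
  · rw [integral_eq_lintegral_pos_part_sub_lintegral_neg_part hf]
    exact (ENNReal.ofReal_le_ofReal (sub_le_self _ ENNReal.toReal_nonneg)).trans
      ENNReal.ofReal_toReal_le
  · simp [integral_undef hf]

theorem measurable_profit (p c q : ℝ) : Measurable fun u : ℝ≥0 => profit p c q u := by
  unfold profit
  fun_prop

theorem integrable_profit_comp [IsFiniteMeasure ν] {U : Ω → ℝ≥0} (hU : Measurable U)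
    (p c : ℝ) {q : ℝ} (hq : 0 ≤ q) : Integrable (fun ω => profit p c q (U ω)) ν := by
  refine Integrable.of_bound ((measurable_profit p c q).comp hU).aestronglyMeasurable
    (|p| * q + |c * q|) (Filter.Eventually.of_forall fun ω => ?_)
  have h0 : 0 ≤ min q (U ω : ℝ) := le_min hq (U ω).2
  calc ‖profit p c q (U ω)‖ ≤ |p * min q (U ω : ℝ)| + |c * q| := abs_sub _ _
    _ ≤ |p| * q + |c * q| := by
        rw [abs_mul, abs_of_nonneg h0]
        gcongr
        exact min_le_left _ _

theorem integrable_of_lintegral_eq_ofReal {V : Ω → ℝ≥0} (hV : Measurable V) {μ : ℝ}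
    (h : ∫⁻ ω, (V ω : ℝ≥0∞) ∂ν = ENNReal.ofReal μ) : Integrable (fun ω => (V ω : ℝ)) ν := by
  refine ⟨by fun_prop, ?_⟩
  simp [HasFiniteIntegral, h]

theorem integral_of_lintegral_eq_ofReal {V : Ω → ℝ≥0} (hV : Measurable V) {μ : ℝ} (hμ : 0 ≤ μ)
    (h : ∫⁻ ω, (V ω : ℝ≥0∞) ∂ν = ENNReal.ofReal μ) : ∫ ω, (V ω : ℝ) ∂ν = μ := by
  have h0 : 0 ≤ᵐ[ν] fun ω => (V ω : ℝ) := Filter.Eventually.of_forall fun ω => (V ω).2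
  rw [integral_eq_lintegral_of_nonneg_ae h0 (by fun_prop)]
  simp [h, hμ]

theorem measurable_twoPoint {X : Type*} [MeasurableSpace X] {A : Set Ω} (hA : MeasurableSet A)
    (a b : X) : Measurable (twoPoint A a b) := by
  classical
  exact Measurable.ite hA measurable_const measurable_const

theorem integrable_twoPoint [IsFiniteMeasure ν] {A : Set Ω} (hA : MeasurableSet A) (a b : ℝ) :
    Integrable (twoPoint A a b) ν := by
  classical
  refine Integrable.of_bound (measurable_twoPoint hA a b).aestronglyMeasurable (max |a| |b|)
    (Filter.Eventually.of_forall fun ω => ?_)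
  unfold twoPoint
  split_ifs <;> simp

theorem integral_twoPoint [IsProbabilityMeasure ν] {A : Set Ω} (hA : MeasurableSet A) (a b : ℝ) :
    ∫ ω, twoPoint A a b ω ∂ν = (1 - ν.real A) * b + ν.real A * a := by
  classical
  have h : twoPoint A a b = A.piecewise (fun _ => a) (fun _ => b) := rfl
  rw [h, integral_piecewise hA (by simp) (by simp)]
  simp [measureReal_compl hA]
  ring

theorem lintegral_twoPoint [IsProbabilityMeasure ν] {A : Set Ω} (hA : MeasurableSet A)
    {a b : ℝ} (ha : 0 ≤ a) (hb : 0 ≤ b) :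
    ∫⁻ ω, ENNReal.ofReal (twoPoint A a b ω) ∂ν =
      ENNReal.ofReal ((1 - ν.real A) * b + ν.real A * a) := by
  rw [← integral_twoPoint hA, ofReal_integral_eq_lintegral_ofReal (integrable_twoPoint hA a b)]
  refine Filter.Eventually.of_forall fun ω => ?_
  change 0 ≤ twoPoint A a b ω
  unfold twoPoint
  split_ifs <;> assumption

end Integrals

/-! ### Couplings and the optimal-transport cost. -/

section Transport

variable {X Ω : Type*} [MeasurableSpace X] [MeasurableSpace Ω]

/-- The distribution of a random variable. -/
noncomputable def distribution (ν : Measure Ω) [IsProbabilityMeasure ν] (U : Ω → X)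
    (hU : Measurable U) : ProbabilityMeasure X :=
  ⟨ν.map U, Measure.isProbabilityMeasure_map hU.aemeasurable⟩

theorem otCost_distribution_le (ν : Measure Ω) [IsProbabilityMeasure ν] {U V : Ω → X}
    (hU : Measurable U) (hV : Measurable V) {cost : X → X → ℝ≥0∞}
    (hcost : Measurable fun z : X × X => cost z.1 z.2) :
    otCost cost (distribution ν U hU) (distribution ν V hV) ≤
      ∫⁻ ω, cost (U ω) (V ω) ∂ν := by
  refine (iInf₂_le (ν.map fun ω => (U ω, V ω)) ⟨?fst, ?snd⟩).trans_eq ?cost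
  case fst =>
    rw [Measure.map_map measurable_fst (hU.prodMk hV)]
    rfl
  case snd =>
    rw [Measure.map_map measurable_snd (hU.prodMk hV)]
    rfl
  case cost => rw [lintegral_map hcost (hU.prodMk hV)]

theorem exists_coupling (F G : ProbabilityMeasure X) : ∃ Γ : Measure (X × X),
    Γ.map Prod.fst = (F : Measure X) ∧ Γ.map Prod.snd = (G : Measure X) :=
  ⟨(F : Measure X).prod G, by simp [Measure.map_fst_prod], by simp [Measure.map_snd_prod]⟩

/-- For `a = 0` multiplication need not pass through the infimum; the independent coupling then
supplies the single instance required. -/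
theorem le_add_mul_otCost {cost : X → X → ℝ≥0∞} {F G : ProbabilityMeasure X} {x y a : ℝ≥0∞}
    (ha : a ≠ ⊤)
    (h : ∀ Γ : Measure (X × X), Γ.map Prod.fst = (F : Measure X) →
      Γ.map Prod.snd = (G : Measure X) → x ≤ y + a * ∫⁻ z, cost z.1 z.2 ∂Γ) :
    x ≤ y + a * otCost cost F G := by
  by_cases h0 : a = 0
  · obtain ⟨Γ, h1, h2⟩ := exists_coupling F G
    simpa [h0] using h Γ h1 h2
  · rw [otCost, ENNReal.mul_iInf_of_ne h0 ha]
    simp only [ENNReal.mul_iInf_of_ne h0 ha, ENNReal.add_iInf₂]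
    exact le_iInf₂ fun Γ hΓ => h Γ hΓ.1 hΓ.2

end Transport

theorem measurable_sqCost : Measurable fun z : ℝ≥0 × ℝ≥0 => sqCost z.1 z.2 := by
  unfold sqCost
  fun_prop

theorem measurable_sqCostMulti {M : ℕ} :
    Measurable fun z : (Fin M → ℝ≥0) × (Fin M → ℝ≥0) => sqCostMulti z.1 z.2 := by
  unfold sqCostMulti
  fun_prop

/-! ### Upper bounds from two-point laws, lower bounds from certificates. -/

section Bounds

/-- The uniform distribution on the unit interval. -/
noncomputable def uniform : Measure ℝ := volume.restrict (Set.Ioc 0 1)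

instance : IsProbabilityMeasure uniform := ⟨by simp [uniform]⟩

theorem uniform_real_Iic {w : ℝ} (h0 : 0 ≤ w) (h1 : w ≤ 1) : uniform.real (Set.Iic w) = w := by
  rw [uniform, measureReal_restrict_apply measurableSet_Iic, Set.inter_comm,
    Set.Ioc_inter_Iic, min_eq_right h1]
  simp [h0]

theorem lintegral_sq_twoPoint {w : ℝ} (h0 : 0 ≤ w) (h1 : w ≤ 1) (a b : ℝ≥0) :
    ∫⁻ ω, ((twoPoint (Set.Iic w) a b ω : ℝ≥0) : ℝ≥0∞) ^ 2 ∂uniform =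
      ENNReal.ofReal ((1 - w) * b ^ 2 + w * a ^ 2) := by
  have := lintegral_twoPoint (ν := uniform) (A := Set.Iic w) measurableSet_Iic
    (sq_nonneg (a : ℝ)) (sq_nonneg (b : ℝ))
  rw [uniform_real_Iic h0 h1] at this
  rw [← this]
  refine lintegral_congr fun ω => ?_
  rw [← comp_twoPoint (fun v : ℝ≥0 => (v : ℝ) ^ 2), ENNReal.ofReal_pow NNReal.zero_le_coe,
    ENNReal.ofReal_coe_nnreal]

theorem lintegral_coe_twoPoint {w : ℝ} (h0 : 0 ≤ w) (h1 : w ≤ 1) (a b : ℝ≥0) :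
    ∫⁻ ω, ((twoPoint (Set.Iic w) a b ω : ℝ≥0) : ℝ≥0∞) ∂uniform =
      ENNReal.ofReal ((1 - w) * b + w * a) := by
  have := lintegral_twoPoint (ν := uniform) (A := Set.Iic w) measurableSet_Iic a.2 b.2
  rw [uniform_real_Iic h0 h1] at this
  change _ = ENNReal.ofReal ((1 - w) * (b : ℝ) + w * (a : ℝ)) at this
  rw [← this]
  refine lintegral_congr fun ω => ?_
  change _ = ENNReal.ofReal (twoPoint (Set.Iic w) (a : ℝ) (b : ℝ) ω)
  rw [← comp_twoPoint (fun v : ℝ≥0 => (v : ℝ)), ENNReal.ofReal_coe_nnreal]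

theorem integral_profit_twoPoint {w : ℝ} (h0 : 0 ≤ w) (h1 : w ≤ 1) (p c q : ℝ) (a b : ℝ≥0) :
    ∫ ω, profit p c q (twoPoint (Set.Iic w) a b ω : ℝ≥0) ∂uniform =
      (1 - w) * profit p c q b + w * profit p c q a := by
  have h := integral_twoPoint (ν := uniform) (A := Set.Iic w) measurableSet_Iic
    (profit p c q a) (profit p c q b)
  rw [uniform_real_Iic h0 h1] at h
  rw [← h]
  exact integral_congr_ae (Filter.Eventually.of_forall fun ω =>
    comp_twoPoint (fun u : ℝ≥0 => profit p c q u) _ a b ω)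

theorem lintegral_sqCost_twoPoint {w : ℝ} (h0 : 0 ≤ w) (h1 : w ≤ 1) (a b a' b' : ℝ≥0) :
    ∫⁻ ω, sqCost (twoPoint (Set.Iic w) a b ω) (twoPoint (Set.Iic w) a' b' ω) ∂uniform =
      ENNReal.ofReal ((1 - w) * ((b : ℝ) - b') ^ 2 + w * ((a : ℝ) - a') ^ 2) := by
  have := lintegral_twoPoint (ν := uniform) (A := Set.Iic w) measurableSet_Iic
    (sq_nonneg ((a : ℝ) - a')) (sq_nonneg ((b : ℝ) - b'))
  rw [uniform_real_Iic h0 h1] at this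
  rw [← this]
  refine lintegral_congr fun ω => ?_
  rw [comp_twoPoint₂ sqCost]
  exact (comp_twoPoint ENNReal.ofReal _ _ _ _).symm

theorem isProbabilityMeasure_of_map_fst {X : Type*} [MeasurableSpace X] {Γ : Measure (X × X)}
    {F : ProbabilityMeasure X} (h : Γ.map Prod.fst = (F : Measure X)) :
    IsProbabilityMeasure Γ := by
  refine ⟨?_⟩
  have h1 : Γ.map Prod.fst Set.univ = 1 := by rw [h, measure_univ]
  rwa [Measure.map_apply measurable_fst MeasurableSet.univ, Set.preimage_univ] at h1

/-- The expected slack of a dual certificate, up to its integrand, at a distribution with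
mean `μ`. -/
theorem integral_certificate {Ω : Type*} [MeasurableSpace Ω] {ν : Measure Ω}
    [IsProbabilityMeasure ν] {V f : Ω → ℝ} (hV : Integrable V ν) (hf : Integrable f ν) {μ : ℝ}
    (hμ : ∫ ω, V ω ∂ν = μ) (P s : ℝ) :
    Integrable (fun ω => P + s * (V ω - μ) - f ω) ν ∧
      ∫ ω, (P + s * (V ω - μ) - f ω) ∂ν = P - ∫ ω, f ω ∂ν := by
  have i1 : Integrable (fun ω => V ω - μ) ν := hV.sub (integrable_const μ)
  have i2 : Integrable (fun ω => s * (V ω - μ)) ν := i1.const_mul s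
  have i3 : Integrable (fun ω => P + s * (V ω - μ)) ν := (integrable_const P).add i2
  refine ⟨i3.sub hf, ?_⟩
  rw [integral_sub i3 hf, integral_add (integrable_const P) i2, integral_const_mul,
    integral_sub hV (integrable_const μ), hμ]
  simp

/-- A two-point reference distribution and a transported copy of it bound the value of the
single-product problem from above. -/
theorem singleValue_le {p c μ α lam w P : ℝ} (hα : 0 ≤ α) (hl : 0 ≤ lam) (h0 : 0 ≤ w) (h1 : w ≤ 1)
    (ul uh vl vh : ℝ≥0) (hmean : (1 - w) * vl + w * vh = μ)
    (hP : ∀ q : ℝ, 0 ≤ q →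
      (1 - w) * (profit p c q ul + α * ((ul : ℝ) - vl) ^ 2) +
        w * (profit p c q uh + α * ((uh : ℝ) - vh) ^ 2) +
        lam * ((1 - w) * vl ^ 2 + w * vh ^ 2) ≤ P) :
    singleValue p c μ α lam ≤ P := by
  have h1' : 0 ≤ 1 - w := sub_nonneg.2 h1
  have hU : Measurable (twoPoint (Set.Iic w) uh ul) := measurable_twoPoint measurableSet_Iic _ _
  have hV : Measurable (twoPoint (Set.Iic w) vh vl) := measurable_twoPoint measurableSet_Iic _ _
  refine iSup_le fun q => (iInf_le _ (distribution uniform _ hU)).trans ?_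
  have hprofit : ∫ u, profit p c q u ∂(distribution uniform _ hU : Measure ℝ≥0) =
      (1 - w) * profit p c q ul + w * profit p c q uh := by
    change ∫ u : ℝ≥0, profit p c q u ∂(uniform.map _) = _
    rw [integral_map hU.aemeasurable (measurable_profit p c q).aestronglyMeasurable,
      integral_profit_twoPoint h0 h1]
  have hG : distribution uniform _ hV ∈ meanSet μ := by
    change ∫⁻ v : ℝ≥0, (v : ℝ≥0∞) ∂(uniform.map _) = _
    rw [lintegral_map (by fun_prop) hV, lintegral_coe_twoPoint h0 h1, hmean]
  rw [hprofit]
  refine EReal.coe_add_ennreal_le (y := lam * ((1 - w) * vl ^ 2 + w * vh ^ 2) +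
    α * ((1 - w) * ((ul : ℝ) - vl) ^ 2 + w * ((uh : ℝ) - vh) ^ 2)) (by positivity)
    (iInf₂_le_of_le _ hG ?_) ?_
  · rw [ENNReal.ofReal_add (by positivity) (by positivity), ENNReal.ofReal_mul hl,
      ENNReal.ofReal_mul hα]
    gcongr
    · change ∫⁻ v : ℝ≥0, (v : ℝ≥0∞) ^ 2 ∂(uniform.map _) ≤ _
      rw [lintegral_map (by fun_prop) hV, lintegral_sq_twoPoint h0 h1]
    · rw [← lintegral_sqCost_twoPoint h0 h1]
      exact otCost_distribution_le uniform hU hV measurable_sqCost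
  · have := hP q q.2
    linarith

/-- A pointwise dual certificate bounds the value of the single-product problem from below. -/
theorem le_singleValue {p c μ α lam P q s : ℝ} (hμ : 0 ≤ μ) (hα : 0 ≤ α) (hl : 0 ≤ lam)
    (hq : 0 ≤ q) (h : ∀ u v : ℝ, 0 ≤ u → 0 ≤ v →
      P + s * (v - μ) ≤ profit p c q u + (lam * v ^ 2 + α * (u - v) ^ 2)) :
    (P : EReal) ≤ singleValue p c μ α lam := by
  refine le_iSup_of_le ⟨q, hq⟩ (le_iInf fun F => EReal.coe_le_coe_add_ennreal
    (le_iInf₂ fun G hG => le_add_mul_otCost ENNReal.ofReal_ne_top fun Γ hF hG' => ?_))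
  have hΓ := isProbabilityMeasure_of_map_fst hF
  have hmean : ∫⁻ z : ℝ≥0 × ℝ≥0, (z.2 : ℝ≥0∞) ∂Γ = ENNReal.ofReal μ := by
    rw [← lintegral_map (f := fun v : ℝ≥0 => (v : ℝ≥0∞)) (by fun_prop) measurable_snd, hG']
    exact hG
  have hi2 := integrable_of_lintegral_eq_ofReal measurable_snd hmean
  have hi1 : Integrable (fun z : ℝ≥0 × ℝ≥0 => profit p c q z.1) Γ :=
    integrable_profit_comp measurable_fst p c hq
  have hprofit : ∫ z, profit p c q z.1 ∂Γ = ∫ u, profit p c q u ∂(F : Measure ℝ≥0) := by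
    rw [← hF, integral_map measurable_fst.aemeasurable
      (measurable_profit p c q).aestronglyMeasurable]
  -- The term with slope `s` integrates to zero, since the second marginal has mean `μ`.
  have hint : ∫ z : ℝ≥0 × ℝ≥0, (P + s * ((z.2 : ℝ) - μ) - profit p c q z.1) ∂Γ =
      P - ∫ u, profit p c q u ∂(F : Measure ℝ≥0) := by
    rw [(integral_certificate hi2 hi1
      (integral_of_lintegral_eq_ofReal measurable_snd hμ hmean) P s).2, hprofit]
  change ENNReal.ofReal (P - ∫ u, profit p c q u ∂(F : Measure ℝ≥0)) ≤ _
  rw [← hint]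
  refine (ofReal_integral_le_lintegral _ _).trans ?_
  calc ∫⁻ z : ℝ≥0 × ℝ≥0, ENNReal.ofReal (P + s * ((z.2 : ℝ) - μ) - profit p c q z.1) ∂Γ
      ≤ ∫⁻ z : ℝ≥0 × ℝ≥0, (ENNReal.ofReal lam * (z.2 : ℝ≥0∞) ^ 2 +
          ENNReal.ofReal α * sqCost z.1 z.2) ∂Γ := by
        refine lintegral_mono fun z => ?_
        rw [sqCost, ← ENNReal.ofReal_coe_nnreal, ← ENNReal.ofReal_pow NNReal.zero_le_coe,
          ← ENNReal.ofReal_mul hl, ← ENNReal.ofReal_mul hα,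
          ← ENNReal.ofReal_add (mul_nonneg hl (sq_nonneg _)) (mul_nonneg hα (sq_nonneg _))]
        exact ENNReal.ofReal_le_ofReal (by linarith [h z.1 z.2 z.1.2 z.2.2])
    _ = _ := by
        rw [lintegral_add_left (by fun_prop), lintegral_const_mul _ (by fun_prop),
          lintegral_const_mul _ measurable_sqCost, ← hG',
          lintegral_map (by fun_prop) measurable_snd]

variable {M : ℕ}

theorem measurable_sum_profit (p c q : Fin M → ℝ) :
    Measurable fun u : Fin M → ℝ≥0 => ∑ i, profit (p i) (c i) (q i) (u i) := by
  unfold profit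
  fun_prop

/-- Counterpart of `singleValue_le` in which the second moment is subject to a budget instead of a
penalty. -/
theorem multiValue_le {p c μ : Fin M → ℝ} {α K R : ℝ} {w : Fin M → ℝ} (hα : 0 ≤ α)
    (h0 : ∀ i, 0 ≤ w i) (h1 : ∀ i, w i ≤ 1) (ul uh vl vh : Fin M → ℝ≥0)
    (hmean : ∀ i, (1 - w i) * vl i + w i * vh i = μ i)
    (hK : ∑ i, ((1 - w i) * (vl i : ℝ) ^ 2 + w i * (vh i : ℝ) ^ 2) ≤ K)
    (hR : ∀ q : Fin M → ℝ≥0, ∑ i,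
      ((1 - w i) * (profit (p i) (c i) (q i) (ul i) + α * ((ul i : ℝ) - vl i) ^ 2) +
        w i * (profit (p i) (c i) (q i) (uh i) + α * ((uh i : ℝ) - vh i) ^ 2)) ≤ R) :
    multiValue p c μ α K ≤ R := by
  have h1' : ∀ i, 0 ≤ 1 - w i := fun i => sub_nonneg.2 (h1 i)
  -- One uniform variable drives all coordinates of both vectors. The dependence between products is
  -- irrelevant, because profits, moments and transport cost are sums over products.
  set U : ℝ → Fin M → ℝ≥0 := fun ω i => twoPoint (Set.Iic (w i)) (uh i) (ul i) ω
  set V : ℝ → Fin M → ℝ≥0 := fun ω i => twoPoint (Set.Iic (w i)) (vh i) (vl i) ω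
  have hU : Measurable U := measurable_pi_lambda _ fun i => measurable_twoPoint measurableSet_Iic _ _
  have hV : Measurable V := measurable_pi_lambda _ fun i => measurable_twoPoint measurableSet_Iic _ _
  refine iSup_le fun q => (iInf_le _ (distribution uniform U hU)).trans ?_
  have hi : ∀ i, Integrable (fun ω => profit (p i) (c i) (q i) (U ω i)) uniform := fun i =>
    integrable_profit_comp ((measurable_pi_apply i).comp hU) _ _ (q i).2
  have hprofit : ∫ u, ∑ i, profit (p i) (c i) (q i) (u i)
        ∂(distribution uniform U hU : Measure (Fin M → ℝ≥0)) =
      ∑ i, ((1 - w i) * profit (p i) (c i) (q i) (ul i) +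
        w i * profit (p i) (c i) (q i) (uh i)) := by
    change ∫ u : Fin M → ℝ≥0, ∑ i, profit (p i) (c i) (q i) (u i) ∂(uniform.map U) = _
    rw [integral_map hU.aemeasurable (measurable_sum_profit p c fun i => q i).aestronglyMeasurable,
      integral_finsetSum _ fun i _ => hi i]
    exact Finset.sum_congr rfl fun i _ => integral_profit_twoPoint (h0 i) (h1 i) _ _ _ _ _
  have hG : distribution uniform V hV ∈ ambiguitySet μ K := by
    refine ⟨fun i => ?_, ?_⟩
    · change ∫⁻ v : Fin M → ℝ≥0, (v i : ℝ≥0∞) ∂(uniform.map V) = _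
      rw [lintegral_map (by fun_prop) hV, lintegral_coe_twoPoint (h0 i) (h1 i), hmean]
    · change ∫⁻ v : Fin M → ℝ≥0, ∑ i, (v i : ℝ≥0∞) ^ 2 ∂(uniform.map V) ≤ _
      rw [lintegral_map (by fun_prop) hV, lintegral_finsetSum _ fun i _ => by fun_prop]
      refine le_trans (le_of_eq ?_) (ENNReal.ofReal_le_ofReal hK)
      rw [ENNReal.ofReal_sum_of_nonneg fun i _ => by have := h1' i; have := h0 i; positivity]
      exact Finset.sum_congr rfl fun i _ => lintegral_sq_twoPoint (h0 i) (h1 i) _ _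
  rw [hprofit]
  have hnn : ∀ i, 0 ≤ (1 - w i) * ((ul i : ℝ) - vl i) ^ 2 + w i * ((uh i : ℝ) - vh i) ^ 2 :=
    fun i => by have := h1' i; have := h0 i; positivity
  refine EReal.coe_add_ennreal_le (y := α * ∑ i,
    ((1 - w i) * ((ul i : ℝ) - vl i) ^ 2 + w i * ((uh i : ℝ) - vh i) ^ 2))
    (mul_nonneg hα (Finset.sum_nonneg fun i _ => hnn i)) ?_ ?_
  · rw [ENNReal.ofReal_mul hα]
    gcongr
    refine (iInf₂_le _ hG).trans ((otCost_distribution_le uniform hU hV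
      measurable_sqCostMulti).trans_eq ?_)
    rw [ENNReal.ofReal_sum_of_nonneg fun i _ => hnn i]
    calc ∫⁻ ω, sqCostMulti (U ω) (V ω) ∂uniform
        = ∫⁻ ω, ∑ i, sqCost (U ω i) (V ω i) ∂uniform := by
          refine lintegral_congr fun ω => ?_
          rw [sqCostMulti, ENNReal.ofReal_sum_of_nonneg fun i _ => sq_nonneg _]
          rfl
      _ = _ := by
          have hm : ∀ i, Measurable fun ω => sqCost (U ω i) (V ω i) := fun i =>
            measurable_sqCost.comp (((measurable_pi_apply i).comp hU).prodMk
              ((measurable_pi_apply i).comp hV))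
          rw [lintegral_finsetSum _ fun i _ => hm i]
          exact Finset.sum_congr rfl fun i _ =>
            lintegral_sqCost_twoPoint (h0 i) (h1 i) _ _ _ _
  · refine le_trans (le_of_eq ?_) (hR q)
    rw [Finset.mul_sum, ← Finset.sum_add_distrib]
    exact Finset.sum_congr rfl fun i _ => by ring

/-- Weak duality: the certificates of all products share `lam`, so after integration the penalty is
`lam` times the total second moment, which is at most `lam * K`. -/
theorem le_multiValue {p c μ : Fin M → ℝ} {α K lam : ℝ} {P q s : Fin M → ℝ} (hμ : ∀ i, 0 ≤ μ i)
    (hα : 0 ≤ α) (hl : 0 ≤ lam) (hK : ∑ i, μ i ^ 2 ≤ K) (hq : ∀ i, 0 ≤ q i)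
    (h : ∀ i, ∀ u v : ℝ, 0 ≤ u → 0 ≤ v →
      P i + s i * (v - μ i) ≤
        profit (p i) (c i) (q i) u + (lam * v ^ 2 + α * (u - v) ^ 2)) :
    ((-(lam * K) + ∑ i, P i : ℝ) : EReal) ≤ multiValue p c μ α K := by
  have hK0 : 0 ≤ K := (Finset.sum_nonneg fun i _ => sq_nonneg _).trans hK
  refine le_iSup_of_le (fun i => ⟨q i, hq i⟩) (le_iInf fun F => EReal.coe_le_coe_add_ennreal ?_)
  set a := ∫ u, ∑ i, profit (p i) (c i) (q i) (u i) ∂(F : Measure (Fin M → ℝ≥0)) with ha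
  change ENNReal.ofReal (-(lam * K) + ∑ i, P i - a) ≤ _
  -- The point mass at `μ`. Nonemptiness matters only for `α = 0`, where the factor does not pass
  -- through the infimum over the set.
  have hG0 : ∃ G, G ∈ ambiguitySet μ K := by
    refine ⟨⟨Measure.dirac fun i => (μ i).toNNReal, inferInstance⟩, fun i => ?_, ?_⟩
    · change ∫⁻ v : Fin M → ℝ≥0, (v i : ℝ≥0∞) ∂Measure.dirac _ = _
      rw [lintegral_dirac' _ (by fun_prop), ENNReal.ofReal]
    · change ∫⁻ v : Fin M → ℝ≥0, ∑ i, (v i : ℝ≥0∞) ^ 2 ∂Measure.dirac _ ≤ _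
      rw [lintegral_dirac' _ (by fun_prop)]
      refine le_trans (le_of_eq ?_) (ENNReal.ofReal_le_ofReal hK)
      rw [ENNReal.ofReal_sum_of_nonneg fun i _ => sq_nonneg _]
      refine Finset.sum_congr rfl fun i _ => ?_
      rw [ENNReal.ofReal_pow (hμ i), ENNReal.ofReal]
  suffices key : ∀ G ∈ ambiguitySet μ K, ENNReal.ofReal (-(lam * K) + ∑ i, P i - a) ≤
      0 + ENNReal.ofReal α * otCost sqCostMulti F G by
    by_cases hα0 : ENNReal.ofReal α = 0
    · obtain ⟨G, hG⟩ := hG0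
      simpa [hα0] using key G hG
    · rw [distToSet, ENNReal.mul_iInf_of_ne hα0 ENNReal.ofReal_ne_top]
      simp only [ENNReal.mul_iInf_of_ne hα0 ENNReal.ofReal_ne_top]
      exact le_iInf₂ fun G hG => by simpa using key G hG
  intro G hG
  refine le_add_mul_otCost ENNReal.ofReal_ne_top fun Γ hF hG' => ?_
  have hΓ := isProbabilityMeasure_of_map_fst hF
  have hm1 : ∀ i, Measurable fun z : (Fin M → ℝ≥0) × (Fin M → ℝ≥0) => z.1 i :=
    fun i => (measurable_pi_apply i).comp measurable_fst
  have hm2 : ∀ i, Measurable fun z : (Fin M → ℝ≥0) × (Fin M → ℝ≥0) => z.2 i :=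
    fun i => (measurable_pi_apply i).comp measurable_snd
  have hmean : ∀ i, ∫⁻ z : (Fin M → ℝ≥0) × (Fin M → ℝ≥0), (z.2 i : ℝ≥0∞) ∂Γ =
      ENNReal.ofReal (μ i) := fun i => by
    rw [← hG.1 i, ← hG', lintegral_map (by fun_prop) measurable_snd]
  have hi2 := fun i => integrable_of_lintegral_eq_ofReal (hm2 i) (hmean i)
  have hi1 : ∀ i, Integrable (fun z : (Fin M → ℝ≥0) × (Fin M → ℝ≥0) =>
      profit (p i) (c i) (q i) (z.1 i)) Γ :=
    fun i => integrable_profit_comp (hm1 i) _ _ (hq i)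
  have hcert := fun i => integral_certificate (hi2 i) (hi1 i)
    (integral_of_lintegral_eq_ofReal (hm2 i) (hμ i) (hmean i)) (P i) (s i)
  have hprofit : ∑ i, ∫ z, profit (p i) (c i) (q i) (z.1 i) ∂Γ = a := by
    rw [← integral_finsetSum _ fun i _ => hi1 i, ha, ← hF,
      integral_map measurable_fst.aemeasurable (measurable_sum_profit p c q).aestronglyMeasurable]
  have hint : ∫ z : (Fin M → ℝ≥0) × (Fin M → ℝ≥0), ∑ i, (P i + s i * ((z.2 i : ℝ) - μ i) -
      profit (p i) (c i) (q i) (z.1 i)) ∂Γ = ∑ i, P i - a := by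
    rw [integral_finsetSum _ fun i _ => (hcert i).1, ← hprofit, ← Finset.sum_sub_distrib]
    exact Finset.sum_congr rfl fun i _ => (hcert i).2
  have hmain : ENNReal.ofReal (∑ i, P i - a) ≤ ENNReal.ofReal (lam * K) +
      ENNReal.ofReal α * ∫⁻ z, sqCostMulti z.1 z.2 ∂Γ := by
    rw [← hint]
    refine (ofReal_integral_le_lintegral _ _).trans ?_
    calc _ ≤ ∫⁻ z : (Fin M → ℝ≥0) × (Fin M → ℝ≥0),
          (ENNReal.ofReal lam * ∑ i, (z.2 i : ℝ≥0∞) ^ 2 +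
            ENNReal.ofReal α * sqCostMulti z.1 z.2) ∂Γ := by
          refine lintegral_mono fun z => ?_
          have e : ∑ i, (z.2 i : ℝ≥0∞) ^ 2 = ENNReal.ofReal (∑ i, (z.2 i : ℝ) ^ 2) := by
            rw [ENNReal.ofReal_sum_of_nonneg fun i _ => sq_nonneg _]
            refine Finset.sum_congr rfl fun i _ => ?_
            rw [ENNReal.ofReal_pow NNReal.zero_le_coe, ENNReal.ofReal_coe_nnreal]
          have n1 : 0 ≤ ∑ i, (z.2 i : ℝ) ^ 2 := Finset.sum_nonneg fun i _ => sq_nonneg _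
          have n2 : 0 ≤ ∑ i, ((z.1 i : ℝ) - z.2 i) ^ 2 := Finset.sum_nonneg fun i _ => sq_nonneg _
          rw [e, sqCostMulti, ← ENNReal.ofReal_mul hl, ← ENNReal.ofReal_mul hα,
            ← ENNReal.ofReal_add (mul_nonneg hl n1) (mul_nonneg hα n2)]
          refine ENNReal.ofReal_le_ofReal ?_
          rw [Finset.mul_sum, Finset.mul_sum, ← Finset.sum_add_distrib]
          exact Finset.sum_le_sum fun i _ => by
            linarith [h i (z.1 i) (z.2 i) (z.1 i).2 (z.2 i).2]
      _ = ENNReal.ofReal lam * ∫⁻ v, ∑ i, (v i : ℝ≥0∞) ^ 2 ∂(G : Measure (Fin M → ℝ≥0)) +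
          ENNReal.ofReal α * ∫⁻ z, sqCostMulti z.1 z.2 ∂Γ := by
          rw [lintegral_add_left (by fun_prop), lintegral_const_mul _ (by fun_prop),
            lintegral_const_mul _ measurable_sqCostMulti, ← hG',
            lintegral_map (by fun_prop) measurable_snd]
      _ ≤ _ := by
          rw [ENNReal.ofReal_mul hl]
          gcongr
          exact hG.2
  rw [zero_add, show -(lam * K) + ∑ i, P i - a = (∑ i, P i - a) - lam * K by ring,
    ENNReal.ofReal_sub _ (mul_nonneg hl hK0)]
  exact tsub_le_iff_left.2 hmain

end Bounds

/-! ### The closed-form value of one product and its supergradient. -/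

section SingleProduct

variable {p c μ α lam : ℝ}

theorem weight_mem (hc : 0 < c) (hcp : c < p) : 0 ≤ c / p ∧ c / p ≤ 1 :=
  ⟨(div_pos hc (hc.trans hcp)).le, (div_le_one (hc.trans hcp)).2 hcp.le⟩

/-- The law that is worst for `lam` is admissible for `lam'` too, and the multiplier only weights
its second moment. The case `lam' = lam` is the upper half of `singleValue_eq`. -/
theorem singleValue_le_supergradient (hc : 0 < c) (hcp : c < p) (hμ : 0 ≤ μ) (hα : 0 ≤ α)
    (hl : 0 ≤ lam) {lam' : ℝ} (hl' : 0 ≤ lam') :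
    singleValue p c μ α lam' ≤
      ((productValue p c μ α lam + (lam' - lam) * secondMoment p c μ α lam : ℝ) : EReal) := by
  have hp := hc.trans hcp
  refine singleValue_le hα hl' (weight_mem hc hcp).1 (weight_mem hc hcp).2
    ⟨transported p α (lowPoint p c μ α lam), transported_nonneg hp hα⟩
    ⟨highPoint p c μ α lam, highPoint_nonneg hc hcp hμ hα hl⟩
    ⟨lowPoint p c μ α lam, lowPoint_nonneg hc hcp hμ hα hl⟩
    ⟨highPoint p c μ α lam, highPoint_nonneg hc hcp hμ hα hl⟩
    (mean_twoPoint hp.ne' _) fun q _ => ?_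
  have h1 := twoPoint_le hc hcp hα q (lowPoint p c μ α lam) (highPoint p c μ α lam)
  have h2 := secondMoment_twoPoint (c := c) (μ := μ) hp.ne' (spread p c μ α lam)
  change _ + lam' * ((1 - c / p) * (lowPoint p c μ α lam) ^ 2 +
    c / p * (highPoint p c μ α lam) ^ 2) ≤ _
  change (1 - c / p) * (lowPoint p c μ α lam) ^ 2 + c / p * (highPoint p c μ α lam) ^ 2 =
    secondMoment p c μ α lam at h2
  rw [h2, productValue]
  exact (add_le_add h1 le_rfl).trans (le_of_eq (by ring))

theorem singleValue_eq (hc : 0 < c) (hcp : c < p) (hμ : 0 ≤ μ) (hα : 0 ≤ α) (hl : 0 ≤ lam) :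
    singleValue p c μ α lam = (productValue p c μ α lam : EReal) := by
  refine le_antisymm ?_ ?_
  · simpa using singleValue_le_supergradient hc hcp hμ hα hl hl
  · obtain ⟨q, s, hq, h⟩ := exists_certificate hc hcp hμ hα hl
    exact le_singleValue hμ hα hl hq h

theorem productValue_le_supergradient (hc : 0 < c) (hcp : c < p) (hμ : 0 ≤ μ) (hα : 0 ≤ α)
    (hl : 0 ≤ lam) {lam' : ℝ} (hl' : 0 ≤ lam') :
    productValue p c μ α lam' ≤
      productValue p c μ α lam + (lam' - lam) * secondMoment p c μ α lam := by
  have := singleValue_le_supergradient hc hcp hμ hα hl hl'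
  rw [singleValue_eq hc hcp hμ hα hl'] at this
  exact_mod_cast this

end SingleProduct

/-! ### The concave dual problem and strong duality. -/

section Dual

variable {M : ℕ} {p c μ : Fin M → ℝ} {α K lam : ℝ}

/-- The sum of the second moments of the worst-case reference distributions. -/
noncomputable def totalMoment (p c μ : Fin M → ℝ) (α lam : ℝ) : ℝ :=
  ∑ i, secondMoment (p i) (c i) (μ i) α lam

theorem dualObjective_eq (hc : ∀ i, 0 < c i) (hcp : ∀ i, c i < p i) (hμ : ∀ i, 0 ≤ μ i)
    (hα : 0 ≤ α) (hl : 0 ≤ lam) :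
    dualObjective p c μ α K lam =
      ((-(lam * K) + ∑ i, productValue (p i) (c i) (μ i) α lam : ℝ) : EReal) := by
  rw [dualObjective, EReal.coe_add, EReal.coe_finset_sum']
  congr 1
  exact Finset.sum_congr rfl fun i _ => singleValue_eq (hc i) (hcp i) (hμ i) hα hl

theorem sum_productValue_le (hc : ∀ i, 0 < c i) (hcp : ∀ i, c i < p i) (hμ : ∀ i, 0 ≤ μ i)
    (hα : 0 ≤ α) (hl : 0 ≤ lam) {lam' : ℝ} (hl' : 0 ≤ lam') :
    ∑ i, productValue (p i) (c i) (μ i) α lam' ≤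
      ∑ i, productValue (p i) (c i) (μ i) α lam + (lam' - lam) * totalMoment p c μ α lam := by
  rw [totalMoment, Finset.mul_sum, ← Finset.sum_add_distrib]
  exact Finset.sum_le_sum fun i _ =>
    productValue_le_supergradient (hc i) (hcp i) (hμ i) hα hl hl'

theorem sum_sq_le_totalMoment (hc : ∀ i, 0 < c i) (hcp : ∀ i, c i < p i) :
    ∑ i, μ i ^ 2 ≤ totalMoment p c μ α lam :=
  Finset.sum_le_sum fun i _ => sq_le_secondMoment (hc i) (hcp i)

theorem continuousOn_totalMoment (hc : ∀ i, 0 < c i) (hcp : ∀ i, c i < p i) (hα : 0 ≤ α) :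
    ContinuousOn (totalMoment p c μ α) (Set.Ici 0) :=
  continuousOn_finsetSum _ fun i _ => continuousOn_secondMoment (hc i) (hcp i) hα

theorem totalMoment_antitoneOn (hc : ∀ i, 0 < c i) (hcp : ∀ i, c i < p i) (hμ : ∀ i, 0 ≤ μ i)
    (hα : 0 ≤ α) : AntitoneOn (totalMoment p c μ α) (Set.Ici 0) :=
  fun _ hx _ hy hxy => Finset.sum_le_sum fun i _ =>
    secondMoment_antitoneOn (hc i) (hcp i) (hμ i) hα hx hy hxy

/-- Each product with `α * μ i = 0` contributes a constant; one product with `α * μ i > 0` already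
makes the sum strict. -/
theorem totalMoment_eq_or_strictAntiOn (hc : ∀ i, 0 < c i) (hcp : ∀ i, c i < p i)
    (hμ : ∀ i, 0 ≤ μ i) (hα : 0 ≤ α) :
    (∀ lam, totalMoment p c μ α lam = ∑ i, μ i ^ 2) ∨
      StrictAntiOn (totalMoment p c μ α) (Set.Ici 0) := by
  by_cases h : ∀ i, α * μ i = 0
  · exact .inl fun lam => Finset.sum_congr rfl fun i _ => secondMoment_eq_of_mul_eq_zero (h i)
  · obtain ⟨i, hi⟩ := not_forall.1 h
    obtain ⟨h1, h2⟩ := mul_ne_zero_iff.1 hi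
    exact .inr fun x hx y hy hxy => Finset.sum_lt_sum
      (fun i _ => secondMoment_antitoneOn (hc i) (hcp i) (hμ i) hα hx hy hxy.le)
      ⟨i, Finset.mem_univ i, secondMoment_strictAntiOn (hc i) (hcp i) ((hμ i).lt_of_ne' h2)
        (hα.lt_of_ne' h1) hx hy hxy⟩

theorem tendsto_totalMoment (hc : ∀ i, 0 < c i) (hcp : ∀ i, c i < p i) :
    Filter.Tendsto (totalMoment p c μ α) Filter.atTop (nhds (∑ i, μ i ^ 2)) :=
  tendsto_finsetSum _ fun i _ => tendsto_secondMoment ((hc i).trans (hcp i))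

theorem isDualOptimal_iff_real (hc : ∀ i, 0 < c i) (hcp : ∀ i, c i < p i)
    (hμ : ∀ i, 0 ≤ μ i) (hα : 0 ≤ α) :
    IsDualOptimal p c μ α K lam ↔ 0 ≤ lam ∧ ∀ lam', 0 ≤ lam' →
      -(lam' * K) + ∑ i, productValue (p i) (c i) (μ i) α lam' ≤
        -(lam * K) + ∑ i, productValue (p i) (c i) (μ i) α lam := by
  refine and_congr_right fun hl => forall₂_congr fun lam' hl' => ?_
  change dualObjective p c μ α K lam' ≤ dualObjective p c μ α K lam ↔ _
  rw [dualObjective_eq hc hcp hμ hα hl, dualObjective_eq hc hcp hμ hα hl', EReal.coe_le_coe_iff]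

/-- The first-order conditions characterize dual optimality. -/
theorem isDualOptimal_iff (hc : ∀ i, 0 < c i) (hcp : ∀ i, c i < p i)
    (hμ : ∀ i, 0 ≤ μ i) (hα : 0 ≤ α) :
    IsDualOptimal p c μ α K lam ↔ 0 ≤ lam ∧ totalMoment p c μ α lam ≤ K ∧
      (lam = 0 ∨ totalMoment p c μ α lam = K) := by
  rw [isDualOptimal_iff_real hc hcp hμ hα]
  refine and_congr_right fun hl => ⟨fun h => ?_, fun ⟨hK, hcomp⟩ lam' hl' => ?_⟩
  · have hcont := continuousOn_totalMoment (μ := μ) hc hcp hα lam hl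
    have hle : totalMoment p c μ α lam ≤ K := by
      -- Moving right to a nearby `y` improves the objective. The supergradient is taken at `y`, not
      -- at `lam`: it bounds the value at `lam` from above by the value at `y`.
      by_contra! hgt
      have hev : ∀ᶠ y in nhdsWithin lam (Set.Ioi lam), K < totalMoment p c μ α y :=
        (hcont.mono fun y (hy : lam < y) => hl.trans hy.le).eventually (lt_mem_nhds hgt)
      obtain ⟨y, hy, hly⟩ := (hev.and self_mem_nhdsWithin).exists
      have hly : lam < y := hly
      have h1 := h y (hl.trans hly.le)
      have h2 := sum_productValue_le hc hcp hμ hα (hl.trans hly.le) hl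
      nlinarith [mul_pos (sub_pos.2 hly) (sub_pos.2 hy)]
    refine ⟨hle, or_iff_not_imp_left.2 fun h0 => hle.antisymm ?_⟩
    by_contra! hlt
    have hl0 : 0 < lam := hl.lt_of_ne' h0
    have hcont' : ContinuousAt (totalMoment p c μ α) lam := hcont.continuousAt (Ici_mem_nhds hl0)
    have hev : ∀ᶠ y in nhdsWithin lam (Set.Iio lam), totalMoment p c μ α y < K ∧ 0 < y :=
      nhdsWithin_le_nhds ((hcont'.eventually (gt_mem_nhds hlt)).and (lt_mem_nhds hl0))
    obtain ⟨y, ⟨hy, hy0⟩, hly⟩ := (hev.and self_mem_nhdsWithin).exists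
    have hly : y < lam := hly
    have h1 := h y hy0.le
    have h2 := sum_productValue_le hc hcp hμ hα hy0.le hl
    nlinarith [mul_pos (sub_pos.2 hly) (sub_pos.2 hy)]
  · have h1 := sum_productValue_le hc hcp hμ hα hl hl'
    rcases hcomp with rfl | hcomp
    · nlinarith [mul_nonneg hl' (sub_nonneg.2 hK)]
    · rw [hcomp] at h1
      linarith

theorem exists_isDualOptimal (hc : ∀ i, 0 < c i) (hcp : ∀ i, c i < p i)
    (hμ : ∀ i, 0 ≤ μ i) (hα : 0 ≤ α) (hK : ∑ i, μ i ^ 2 < K) :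
    ∃ lam, IsDualOptimal p c μ α K lam := by
  simp only [isDualOptimal_iff hc hcp hμ hα]
  rcases le_or_gt (totalMoment p c μ α 0) K with h | h
  · exact ⟨0, le_rfl, h, .inl rfl⟩
  · obtain ⟨b, hb, hb0⟩ := (((tendsto_totalMoment (α := α) hc hcp).eventually
      (gt_mem_nhds hK)).and (Filter.eventually_ge_atTop 0)).exists
    obtain ⟨x, hx, hxK⟩ := intermediate_value_Icc' hb0
      ((continuousOn_totalMoment hc hcp hα).mono Set.Icc_subset_Ici_self) ⟨hb.le, h.le⟩
    exact ⟨x, hx.1, hxK.le, .inr hxK⟩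

/-- The larger of two optima is positive, so its total moment is `K`. A constant moment contradicts
`∑ i, μ i ^ 2 < K`; a strictly decreasing one would exceed `K` at the smaller optimum. -/
theorem isDualOptimal_unique (hc : ∀ i, 0 < c i) (hcp : ∀ i, c i < p i)
    (hμ : ∀ i, 0 ≤ μ i) (hα : 0 ≤ α) (hK : ∑ i, μ i ^ 2 < K) {x y : ℝ}
    (hx : IsDualOptimal p c μ α K x) (hy : IsDualOptimal p c μ α K y) : x = y := by
  wlog hxy : x < y generalizing x y
  · rcases (not_lt.1 hxy).eq_or_lt with h | h
    · exact h.symm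
    · exact (this hy hx h).symm
  rw [isDualOptimal_iff hc hcp hμ hα] at hx hy
  have hyK := hy.2.2.resolve_left (hx.1.trans_lt hxy).ne'
  rcases totalMoment_eq_or_strictAntiOn hc hcp hμ hα with h | h
  · rw [h] at hyK
    exact absurd hyK hK.ne
  · have := h hx.1 hy.1 hxy
    linarith [hx.2.1]

/-- Adding the two optimality inequalities cancels the values and leaves `(y - x) * (K₂ - K₁) ≤ 0`.
-/
theorem isDualOptimal_antitone (hc : ∀ i, 0 < c i) (hcp : ∀ i, c i < p i)
    (hμ : ∀ i, 0 ≤ μ i) (hα : 0 ≤ α) {K₁ K₂ x y : ℝ} (hK : K₁ < K₂)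
    (hx : IsDualOptimal p c μ α K₁ x) (hy : IsDualOptimal p c μ α K₂ y) : y ≤ x := by
  rw [isDualOptimal_iff_real hc hcp hμ hα] at hx hy
  have h1 := hx.2 y hy.1
  have h2 := hy.2 x hx.1
  by_contra! h
  nlinarith [mul_pos (sub_pos.2 h) (sub_pos.2 hK)]

/-- Two-point reference distributions with the prescribed means bound the optimal value. -/
theorem multiValue_le_huber (hc : ∀ i, 0 < c i) (hcp : ∀ i, c i < p i) (hα : 0 ≤ α)
    {r : Fin M → ℝ} (hlow : ∀ i, 0 ≤ μ i - c i * r i)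
    (hhigh : ∀ i, 0 ≤ μ i + (p i - c i) * r i)
    (hK : ∑ i, (μ i ^ 2 + c i * (p i - c i) * r i ^ 2) ≤ K) :
    multiValue p c μ α K ≤
      ((∑ i, (1 - c i / p i) * huber (p i) α (μ i - c i * r i) : ℝ) : EReal) := by
  have hp := fun i => (hc i).trans (hcp i)
  refine multiValue_le hα (fun i => (weight_mem (hc i) (hcp i)).1)
    (fun i => (weight_mem (hc i) (hcp i)).2)
    (fun i => ⟨transported (p i) α (μ i - c i * r i), transported_nonneg (hp i) hα⟩)
    (fun i => ⟨_, hhigh i⟩) (fun i => ⟨_, hlow i⟩) (fun i => ⟨_, hhigh i⟩)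
    (fun i => mean_twoPoint (hp i).ne' _) ?_ fun q => ?_
  · refine le_trans (Finset.sum_le_sum fun i _ => ?_) hK
    exact (secondMoment_twoPoint (hp i).ne' _).le
  · exact Finset.sum_le_sum fun i _ => twoPoint_le (hc i) (hcp i) hα _ _ _

theorem multiValue_eq_iSup (hc : ∀ i, 0 < c i) (hcp : ∀ i, c i < p i)
    (hμ : ∀ i, 0 ≤ μ i) (hα : 0 ≤ α) (hK : ∑ i, μ i ^ 2 ≤ K) :
    multiValue p c μ α K = ⨆ (lam : ℝ) (_ : 0 ≤ lam), dualObjective p c μ α K lam := by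
  refine le_antisymm ?_ (iSup₂_le fun lam hl => ?_)
  · rcases hK.eq_or_lt with hK | hK
    -- On the boundary the dual supremum may be attained only in the limit `lam → ∞`, where `spread`
    -- vanishes; the primal bound uses the point mass at `μ`.
    · refine (multiValue_le_huber (r := fun _ => 0) hc hcp hα (by simpa using hμ)
        (by simpa using hμ) (by simpa using hK.le)).trans ?_
      have hlim : Filter.Tendsto (fun lam => ∑ i, (1 - c i / p i) *
          huber (p i) α (lowPoint (p i) (c i) (μ i) α lam)) Filter.atTop
          (nhds (∑ i, (1 - c i / p i) * huber (p i) α (μ i - c i * 0))) := by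
        refine tendsto_finsetSum _ fun i _ => Filter.Tendsto.const_mul _ ?_
        have hp := (hc i).trans (hcp i)
        exact ((continuous_huber hα hp).tendsto _).comp
          (((tendsto_spread hp).const_mul (c i)).const_sub (μ i))
      refine le_of_tendsto ((continuous_coe_real_ereal.tendsto _).comp hlim) ?_
      filter_upwards [Filter.eventually_ge_atTop 0] with lam hl
      refine le_trans ?_ (le_iSup₂ (f := fun lam (_ : 0 ≤ lam) => dualObjective p c μ α K lam)
        lam hl)
      rw [dualObjective_eq hc hcp hμ hα hl]
      refine EReal.coe_le_coe_iff.2 ?_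
      simp only [productValue, Finset.sum_add_distrib, ← Finset.mul_sum]
      have := mul_le_mul_of_nonneg_left (sum_sq_le_totalMoment (μ := μ) (α := α) (lam := lam)
        hc hcp) hl
      rw [hK, totalMoment] at this
      linarith
    · obtain ⟨lam, hopt⟩ := exists_isDualOptimal hc hcp hμ hα hK
      obtain ⟨hl, hm, hcomp⟩ := (isDualOptimal_iff hc hcp hμ hα).1 hopt
      refine (multiValue_le_huber (r := fun i => spread (p i) (c i) (μ i) α lam) hc hcp hα
        (fun i => lowPoint_nonneg (hc i) (hcp i) (hμ i) hα hl)
        (fun i => highPoint_nonneg (hc i) (hcp i) (hμ i) hα hl) hm).trans ?_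
      refine le_trans ?_ (le_iSup₂ (f := fun lam (_ : 0 ≤ lam) => dualObjective p c μ α K lam)
        lam hl)
      rw [dualObjective_eq hc hcp hμ hα hl]
      refine EReal.coe_le_coe_iff.2 (le_of_eq ?_)
      simp only [productValue, Finset.sum_add_distrib, ← Finset.mul_sum]
      -- Complementary slackness cancels the penalty against `lam * K`.
      have : lam * totalMoment p c μ α lam = lam * K := by
        rcases hcomp with rfl | h
        · simp
        · rw [h]
      rw [totalMoment] at this
      rw [this]
      simp [lowPoint]
  · rw [dualObjective_eq hc hcp hμ hα hl]
    choose q s hq h using fun i => exists_certificate (hc i) (hcp i) (hμ i) hα hl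
    exact le_multiValue hμ hα hl hK hq h

end Dual

/-! ### Locating the dual optimum among the breakpoints. -/

section Breakpoints

variable {M : ℕ} {p c μ : Fin M → ℝ} {α K : ℝ}

theorem lamBar_succ (i : Fin M) :
    lamBar p c μ α (i.val + 1) = breakpoint (p i) (c i) (μ i) α := by
  simp [lamBar]

theorem lamBar_of_lt {j : ℕ} (h : M < j) : lamBar p c μ α j = ⊤ := by
  obtain ⟨j, rfl⟩ := Nat.exists_eq_succ_of_ne_zero (Nat.ne_zero_of_lt h)
  have : ¬ j < M := by omega
  simp [lamBar, this]

theorem lamBar_monotone (hmono : Monotone fun i => breakpoint (p i) (c i) (μ i) α) :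
    Monotone (lamBar p c μ α) := by
  intro j k hjk
  rcases Nat.eq_zero_or_pos j with rfl | hj
  · exact zero_le
  by_cases hk : M < k
  · rw [lamBar_of_lt hk]
    exact le_top
  · obtain ⟨j, rfl⟩ := Nat.exists_eq_succ_of_ne_zero hj.ne'
    obtain ⟨k, rfl⟩ := Nat.exists_eq_succ_of_ne_zero (hj.trans_le hjk).ne'
    have h1 := lamBar_succ (p := p) (c := c) (μ := μ) (α := α) ⟨j, by omega⟩
    have h2 := lamBar_succ (p := p) (c := c) (μ := μ) (α := α) ⟨k, by omega⟩
    simp only [Nat.succ_eq_add_one, h1, h2]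
    exact hmono (by simpa using hjk)

/-- In `ℝ≥0∞`, `p / 0 = ⊤`, so the truncated difference is `0` and `c / 0 = ⊤`. -/
theorem lamBar_of_alpha_zero (hc : ∀ i, 0 < c i) (hcp : ∀ i, c i < p i) {j : ℕ} (hj : j ≠ 0) :
    lamBar p c μ 0 j = ⊤ := by
  by_cases h : M < j
  · exact lamBar_of_lt h
  · obtain ⟨j, rfl⟩ := Nat.exists_eq_succ_of_ne_zero hj
    have h1 := lamBar_succ (p := p) (c := c) (μ := μ) (α := 0) ⟨j, by omega⟩
    have hp := (hc ⟨j, by omega⟩).trans (hcp ⟨j, by omega⟩)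
    simp only [Nat.succ_eq_add_one, h1, breakpoint, ENNReal.ofReal_zero]
    rw [ENNReal.div_zero (by simpa using hp), ENNReal.sub_top, ENNReal.div_zero (by simpa using hc _)]

/-- The total second moment on `[0, ∞]`. -/
noncomputable def extendedMoment (p c μ : Fin M → ℝ) (α : ℝ) (x : ℝ≥0∞) : ℝ :=
  if x = ⊤ then ∑ i, μ i ^ 2 else totalMoment p c μ α x.toReal

theorem extendedMoment_ofReal {lam : ℝ} (hl : 0 ≤ lam) :
    extendedMoment p c μ α (ENNReal.ofReal lam) = totalMoment p c μ α lam := by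
  simp [extendedMoment, ENNReal.toReal_ofReal hl]

theorem extendedMoment_antitone (hc : ∀ i, 0 < c i) (hcp : ∀ i, c i < p i)
    (hμ : ∀ i, 0 ≤ μ i) (hα : 0 ≤ α) : Antitone (extendedMoment p c μ α) := by
  intro x y hxy
  unfold extendedMoment
  by_cases hy : y = ⊤
  · rw [if_pos hy]
    split_ifs
    · exact le_rfl
    · exact sum_sq_le_totalMoment hc hcp
  · rw [if_neg hy, if_neg (ne_top_of_le_ne_top hy hxy)]
    exact totalMoment_antitoneOn hc hcp hμ hα ENNReal.toReal_nonneg ENNReal.toReal_nonneg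
      (ENNReal.toReal_mono hy hxy)

/-- Between two consecutive breakpoints `Θ_j` is the total second moment. -/
theorem theta_eq_extendedMoment (hc : ∀ i, 0 < c i) (hcp : ∀ i, c i < p i)
    (hα : 0 < α) (hmono : Monotone fun i => breakpoint (p i) (c i) (μ i) α) {j : ℕ}
    {x : ℝ≥0∞} (h1 : lamBar p c μ α (j - 1) ≤ x) (h2 : x ≤ lamBar p c μ α j) :
    theta p c μ α j x = extendedMoment p c μ α x := by
  unfold theta extendedMoment
  split_ifs with hx
  · rfl
  obtain ⟨lam, hl, rfl⟩ : ∃ lam : ℝ, 0 ≤ lam ∧ x = ENNReal.ofReal lam :=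
    ⟨x.toReal, ENNReal.toReal_nonneg, (ENNReal.ofReal_toReal hx).symm⟩
  rw [ENNReal.toReal_ofReal hl, thetaFin, totalMoment,
    ← Finset.sum_filter_add_sum_filter_not Finset.univ (fun i : Fin M => j ≤ i.val + 1)]
  simp only [not_le]
  congr 1
  -- Products numbered `j` or more have not passed their breakpoint, the earlier ones have. Both
  -- formulas hold at a breakpoint, so both endpoints are allowed.
  · refine Finset.sum_congr rfl fun i hi => (secondMoment_of_le (hc i) (hcp i) hα hl ?_).symm
    rw [← ofReal_le_breakpoint_iff (hc i) (hcp i) hα hl, ← lamBar_succ]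
    exact h2.trans (lamBar_monotone hmono (Finset.mem_filter.1 hi).2)
  · refine Finset.sum_congr rfl fun i hi => (secondMoment_of_ge (hc i) (hcp i) hα hl ?_).symm
    refine le_of_breakpoint_le_ofReal (hc i) (hcp i) hα hl ?_
    rw [← lamBar_succ]
    exact (lamBar_monotone hmono (Nat.le_sub_one_of_lt (Finset.mem_filter.1 hi).2)).trans h1

theorem exists_isLeast_indexSet (hK : ∑ i, μ i ^ 2 < K) :
    ∃ j, IsLeast (indexSet p c μ α K) j := by
  have hne : (indexSet p c μ α K).Nonempty :=
    ⟨M + 1, by simp, le_rfl, by rw [lamBar_of_lt (Nat.lt_succ_self M)]; simpa [theta] using hK⟩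
  exact ⟨sInf _, Nat.sInf_mem hne, fun _ h => Nat.sInf_le h⟩

/-- Without misspecification aversion the first index is selected and the multiplier vanishes. -/
theorem characterization_of_alpha_zero (hc : ∀ i, 0 < c i) (hcp : ∀ i, c i < p i)
    (hμ : ∀ i, 0 ≤ μ i) (hK : ∑ i, μ i ^ 2 < K) {j : ℕ}
    (hj : IsLeast (indexSet p c μ 0 K) j) {lamStar : ℝ} (hopt : IsDualOptimal p c μ 0 K lamStar) :
    theta p c μ 0 j (lamBar p c μ 0 (j - 1)) ≤ K ∧
      ENNReal.ofReal lamStar = lamBar p c μ 0 (j - 1) := by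
  have hmem : 1 ∈ indexSet p c μ 0 K := by
    refine ⟨le_rfl, by omega, ?_⟩
    rw [lamBar_of_alpha_zero hc hcp one_ne_zero]
    simpa [theta] using hK
  obtain rfl : j = 1 := le_antisymm (hj.2 hmem) hj.1.1
  have hm : totalMoment p c μ 0 lamStar = ∑ i, μ i ^ 2 :=
    Finset.sum_congr rfl fun i _ => secondMoment_eq_of_mul_eq_zero (zero_mul _)
  have hK0 : 0 ≤ K := (Finset.sum_nonneg fun i _ => sq_nonneg (μ i)).trans hK.le
  obtain ⟨hl, -, h⟩ := (isDualOptimal_iff hc hcp hμ le_rfl).1 hopt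
  -- At `α = lam = 0` every summand of `thetaFin` is `0 / 0 = 0`, so `0 ≤ K` suffices.
  refine ⟨by simpa [theta, thetaFin, lamBar] using hK0, ?_⟩
  rcases h with rfl | h
  · simp [lamBar]
  · exact absurd (hm.symm.trans h) hK.ne

/-- For `j = 1` the breakpoint is `0`, where slackness is free. For `j > 1` minimality of `j` gives
`K ≤ theta` with index `j - 1` at the breakpoint `j - 1`; both indices give the same value there, so
the total moment equals `K`. -/
theorem eq_breakpoint_of_theta_le (hc : ∀ i, 0 < c i) (hcp : ∀ i, c i < p i)
    (hμ : ∀ i, 0 ≤ μ i) (hα : 0 < α)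
    (hmono : Monotone fun i => breakpoint (p i) (c i) (μ i) α) (hK : ∑ i, μ i ^ 2 < K) {j : ℕ}
    (hj : IsLeast (indexSet p c μ α K) j) {lamStar : ℝ} (hopt : IsDualOptimal p c μ α K lamStar)
    (h : theta p c μ α j (lamBar p c μ α (j - 1)) ≤ K) :
    ENNReal.ofReal lamStar = lamBar p c μ α (j - 1) := by
  have hbar := lamBar_monotone hmono
  rw [theta_eq_extendedMoment hc hcp hα hmono le_rfl (hbar (Nat.sub_le j 1))] at h
  have hle : ∀ y : ℝ, 0 ≤ y → totalMoment p c μ α y ≤ K →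
      (y = 0 ∨ totalMoment p c μ α y = K) → ENNReal.ofReal lamStar = ENNReal.ofReal y :=
    fun y hy h1 h2 => by
      rw [isDualOptimal_unique hc hcp hμ hα.le hK hopt
        ((isDualOptimal_iff hc hcp hμ hα.le).2 ⟨hy, h1, h2⟩)]
  by_cases h1 : j = 1
  · subst h1
    simp only [Nat.sub_self, lamBar] at h ⊢
    rw [← ENNReal.ofReal_zero] at h ⊢
    rw [extendedMoment_ofReal le_rfl] at h
    exact hle 0 le_rfl h (.inl rfl)
  · have hj1 : 1 ≤ j := hj.1.1
    have hjM : j ≤ M + 1 := hj.1.2.1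
    have hnot : j - 1 ∉ indexSet p c μ α K := fun hmem => by
      have := hj.2 hmem
      omega
    have hge : K ≤ theta p c μ α (j - 1) (lamBar p c μ α (j - 1)) := by
      by_contra! hlt
      exact hnot ⟨by omega, by omega, hlt⟩
    rw [theta_eq_extendedMoment hc hcp hα hmono (hbar (Nat.sub_le _ 1)) le_rfl] at hge
    have heq := h.antisymm hge
    have htop : lamBar p c μ α (j - 1) ≠ ⊤ := fun htop => by
      rw [htop, extendedMoment, if_pos rfl] at heq
      exact hK.ne heq
    rw [← ENNReal.ofReal_toReal htop] at heq ⊢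
    rw [extendedMoment_ofReal ENNReal.toReal_nonneg] at heq
    exact hle _ ENNReal.toReal_nonneg heq.le (.inr heq)

/-- The total moment is above `K` at the left breakpoint and below it at the right one. By
monotonicity the optimum lies strictly between, hence is positive and satisfies the equation;
conversely a solution satisfies the first-order conditions and uniqueness applies. -/
theorem eq_iff_of_lt_theta (hc : ∀ i, 0 < c i) (hcp : ∀ i, c i < p i)
    (hμ : ∀ i, 0 ≤ μ i) (hα : 0 < α)
    (hmono : Monotone fun i => breakpoint (p i) (c i) (μ i) α) (hK : ∑ i, μ i ^ 2 < K) {j : ℕ}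
    (hj : IsLeast (indexSet p c μ α K) j) {lamStar : ℝ} (hopt : IsDualOptimal p c μ α K lamStar)
    (h : K < theta p c μ α j (lamBar p c μ α (j - 1))) {lam : ℝ} (hl : 0 ≤ lam) :
    lam = lamStar ↔ lamBar p c μ α (j - 1) < ENNReal.ofReal lam ∧
      ENNReal.ofReal lam < lamBar p c μ α j ∧ theta p c μ α j (ENNReal.ofReal lam) = K := by
  have hbar := lamBar_monotone hmono
  have hanti := extendedMoment_antitone hc hcp hμ hα.le
  rw [theta_eq_extendedMoment hc hcp hα hmono le_rfl (hbar (Nat.sub_le j 1))] at h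
  have hjK := hj.1.2.2
  rw [theta_eq_extendedMoment hc hcp hα hmono (hbar (Nat.sub_le j 1)) le_rfl] at hjK
  constructor
  · rintro rfl
    obtain ⟨-, hm, hcomp⟩ := (isDualOptimal_iff hc hcp hμ hα.le).1 hopt
    rw [← extendedMoment_ofReal hl] at hm hcomp
    have h1 : lamBar p c μ α (j - 1) < ENNReal.ofReal lam := by
      by_contra! hle
      exact (hm.trans_lt h).not_ge (hanti hle)
    have hpos : lam ≠ 0 := by
      rintro rfl
      simp at h1
    have hmK := hcomp.resolve_left hpos
    have h2 : ENNReal.ofReal lam < lamBar p c μ α j := by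
      by_contra! hle
      exact (hjK.trans_eq hmK.symm).not_ge (hanti hle)
    exact ⟨h1, h2, by rw [theta_eq_extendedMoment hc hcp hα hmono h1.le h2.le, hmK]⟩
  · rintro ⟨h1, h2, h3⟩
    rw [theta_eq_extendedMoment hc hcp hα hmono h1.le h2.le, extendedMoment_ofReal hl] at h3
    exact isDualOptimal_unique hc hcp hμ hα.le hK
      ((isDualOptimal_iff hc hcp hμ hα.le).2 ⟨hl, h3.le, .inr h3⟩) hopt

end Breakpoints

theorem theorem4 {M : ℕ} (p c μ : Fin M → ℝ) (α : ℝ)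
    (hc : ∀ i, 0 < c i) (hcp : ∀ i, c i < p i) (hμ : ∀ i, 0 ≤ μ i) (hα : 0 ≤ α) :
    -- strong duality, whenever the ambiguity set is nonempty
    (∀ K : ℝ, ∑ i, μ i ^ 2 ≤ K →
      multiValue p c μ α K = ⨆ (lam : ℝ) (_ : 0 ≤ lam), dualObjective p c μ α K lam) ∧
    -- the optimal dual variable exists and is unique
    (∀ K : ℝ, ∑ i, μ i ^ 2 < K → ∃! lam : ℝ, IsDualOptimal p c μ α K lam) ∧
    -- it is decreasing in `K`
    (∀ K₁ K₂ lam₁ lam₂ : ℝ, 0 ≤ K₁ → K₁ < K₂ →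
      IsDualOptimal p c μ α K₁ lam₁ → IsDualOptimal p c μ α K₂ lam₂ → lam₂ ≤ lam₁) ∧
    -- its characterization, for products arranged by increasing breakpoints
    (Monotone (fun i => breakpoint (p i) (c i) (μ i) α) →
      ∀ K : ℝ, ∑ i, μ i ^ 2 < K → ∃ istar : ℕ,
        IsLeast (indexSet p c μ α K) istar ∧
        ∀ lamStar : ℝ, IsDualOptimal p c μ α K lamStar →
          (theta p c μ α istar (lamBar p c μ α (istar - 1)) ≤ K →
            ENNReal.ofReal lamStar = lamBar p c μ α (istar - 1)) ∧
          (K < theta p c μ α istar (lamBar p c μ α (istar - 1)) →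
            ∀ lam : ℝ, 0 ≤ lam →
              (lam = lamStar ↔
                lamBar p c μ α (istar - 1) < ENNReal.ofReal lam ∧
                ENNReal.ofReal lam < lamBar p c μ α istar ∧
                theta p c μ α istar (ENNReal.ofReal lam) = K))) := by
  refine ⟨fun K hK => multiValue_eq_iSup hc hcp hμ hα hK, fun K hK => ?_,
    fun K₁ K₂ lam₁ lam₂ _ hK h₁ h₂ => isDualOptimal_antitone hc hcp hμ hα hK h₁ h₂,
    fun hmono K hK => ?_⟩
  · obtain ⟨lam, hlam⟩ := exists_isDualOptimal hc hcp hμ hα hK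
    exact ⟨lam, hlam, fun y hy => isDualOptimal_unique hc hcp hμ hα hK hy hlam⟩
  · obtain ⟨j, hj⟩ := exists_isLeast_indexSet hK
    refine ⟨j, hj, fun lamStar hopt => ?_⟩
    rcases hα.eq_or_lt with rfl | hα
    · obtain ⟨h1, h2⟩ := characterization_of_alpha_zero hc hcp hμ hK hj hopt
      exact ⟨fun _ => h2, fun h => absurd h h1.not_gt⟩
    · exact ⟨eq_breakpoint_of_theta_le hc hcp hμ hα hmono hK hj hopt,
        fun h lam hl => eq_iff_of_lt_theta hc hcp hμ hα hmono hK hj hopt h hl⟩
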